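/- **Setting.** A finite set $\mathcal V$ of agents has the dynamics $\dot x_i=f_i(x_i)+g_i(x_i)u_i+w_i(x,t)$, $x_i\in\mathbb R^{n_i}$, $u_i\in\mathbb R^{m_i}$, where $x=(x_i)_{i\in\mathcal V}$, $f_i,g_i$ are locally Lipschitz, $g_ig_i^\top$ is positive definite everywhere, and $w_i$ is continuous and uniformly bounded for $t\ge 0$. The communication graph $\mathcal G_C$ is undirected and connected; $D_{ij}$ is its distance, $\mathcal N_i$ the set of neighbors of $i$, and $\mathcal N_i^{k}=\{j: 2\le D_{ij}\le k\}$ the set of $k$-hop neighbors. A *prescribed performance function* (PPF) is a $C^1$ function $[0,\infty)\to(0,\infty)$ that is bounded and has a bounded derivative. **Tasks.** Each agent $i$ has a task $\phi_i$ of the form $G_{[a,b]}\psi_i$, $F_{[a,b]}\psi_i$ or $F_{[\underline a,\underline b]}G_{[\bar a,\bar b]}\psi_i$ (all intervals in $[0,\infty)$), where $\psi_i$ is a conjunction of predicates $P(x)\ge 0$, negated predicates, and $\top$. Let $\rho_i=\rho^{\psi_i}$ be its robustness ($P$ for a predicate, $-P$ for a negated one, and for conjunctions the minimum or the smooth minimum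 $-\frac1\eta\ln\sum_r e^{-\eta\rho_r}$, $\eta>0$). The global task is $\phi=\bigwedge_i\phi_i$. The task graph $\mathcal G_T$ has an edge $(i,j)$ when $\rho_i$ depends on $x_j$; let $\mathcal N^T_i$ consist of $i$ and its out-neighbors, and $\mathcal M_i=\mathcal N_i^T\setminus(\mathcal N_i\cup\{i\})$. *Clusters* $\mathcal V_l$ are the connected components of $\mathcal G_C\cap\mathcal G_T$ (orientation forgotten), $\phi^c_l=\bigwedge_{i\in\mathcal V_l}\phi_i$; the cluster-induced graph has an edge from one cluster to a different one when $\mathcal G_T$ has an edge from an agent of the first to an agent of the second. Assume: - $\mathcal G_T$ (self-loops disregarded) and the cluster-induced graph are acyclic, and agents of the same cluster joined by an edge of $\mathcal G_T$ communicate; - $\rho_i$ is concave, is $C^1$ except possibly at global maximum points, $\partial\rho_i/\partial x_i=0$ only at global maximum points, and $\rho_i$ is well posed: for all $C,R$ there is $\bar C$ such that $\rho_i(x)\ge C$ and $\|x_j\|\le R$ for all $j\in\mathcal N^T_i\setminus\{i\}$ imply $\|x_i\|\le\bar C$. **Observers.** Take $k\ge D_{ij}$ for all $i$ and $j\in\mathcal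 M_i$. For $j\in\mathcal N_i^k$, agent $j$ carries an estimate $\hat x_i^j$ of $x_i$. Put $\xi_i^j=\sum_{l\in\mathcal N_j\cap\mathcal N_i^k}(\hat x_i^j-\hat x_i^l)+|\mathcal N_j\cap\mathcal N_i|(\hat x_i^j-x_i)$ and, componentwise, $\dot{\hat x}_i^j=-(\rho_i^j)^{-1}\,\frac{2}{1-e^2}\,\ln\frac{1+e}{1-e}$ with $e=\xi_i^j/\rho_i^j$. Here $\rho_i^j,\delta_i^j$ are PPFs (one per component) with $\sum_{r\in\mathcal N_i^k}|(M_i^{-1})_{j,r}|\,\rho_i^r(t)\le\delta_i^j(t)$ for all $t\ge0$, where $M_i$ is the Laplacian of the subgraph of $\mathcal G_C$ induced by $\mathcal N_i^k$ plus the diagonal matrix with entries $|\mathcal N_j\cap\mathcal N_i|$. **Funnels.** Let $\hat x_{\phi_i}$ be $x$ with $x_j$ replaced by $\hat x_j^i$ for $j\in\mathcal M_i$. Let $T_i$ be the time window of $\phi_i$: $[a,b]$ for $G_{[a,b]}$, $\{t_i^*\}$ with $t_i^*\in[a,b]$ for $F_{[a,b]}$, $[t_i^*+\bar a,t_i^*+\bar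 b]$ with $t_i^*\in[\underline a,\underline b]$ for $FG$. Let $0<\rho_i^{\max}<\sup\rho_i$, let $\gamma_i$ be a PPF with $\gamma_i<\rho_i^{\max}$ on $T_i$, and let $\rho_i^t$ be a PPF (or $0$ if $\mathcal M_i=\emptyset$) such that for all $t\ge0$, all true states $x$ and all estimates whose errors are componentwise less than $\delta_j^i(t)$ in absolute value for $j\in\mathcal M_i$, $\rho_i(\hat x_{\phi_i})-\rho_i^t(t)>0$ implies $\rho_i(x)>0$. Assume $\Gamma_i:=\gamma_i-\rho_i^t>0$ on $[0,\infty)$, $\max_{T_i}\rho_i^t<\rho_i^{\max}$ for all $i$, and $\sup_x\min_i[\rho_i(x)-\max_{T_i}\rho_i^t]>0$. **Theorem.** Let the initial values satisfy $-\Gamma_i(0)<\rho_i(\hat x_{\phi_i}(0))-\rho_i^{\max}<0$ for all $i$, and $|\xi_i^j(0)|<\rho_i^j(0)$ componentwise for all $i$ and $j\in\mathcal N_i^k$. Let every agent $i$, in cluster $\mathcal V_l$, apply $$u_i=-g_i(x_i)^\top\sum_{j\in\mathcal V_l}\frac{\partial\rho_j(\hat x_{\phi_j})}{\partial x_i}\,\Gamma_j^{-1}J_j\,\varepsilon_j,\qquad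 e_j=\frac{\rho_j(\hat x_{\phi_j})-\rho_j^{\max}}{\Gamma_j},\quad \varepsilon_j=\ln\Big(-\frac{e_j+1}{e_j}\Big),\quad J_j=-\frac1{e_j(e_j+1)} .$$ Then the closed loop of agents, observers and controllers has a solution on $[0,\infty)$ with these initial values; every solution with these initial values on an interval $[0,T)$ extends to one on $[0,\infty)$; and every such solution on $[0,\infty)$ satisfies $-\Gamma_i<\rho_i(\hat x_{\phi_i})-\rho_i^{\max}<0$ and $|\xi_i^j|<\rho_i^j$ for all times (so that observers and controllers are well defined), satisfies $\phi_l^c$ for every cluster $\mathcal V_l$, and hence satisfies $\phi$. -/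

import Mathlib

open Set

namespace STLControl

section Formulas

/-- Non-temporal formulas `ψ ::= ⊤ | μ | ¬ μ | ψ₁ ∧ ψ₂` over a state space `X`. A predicate `μ` is given
by its predicate function `P : X → ℝ`. Regularity is imposed later, on the robustness function. -/
inductive NonTemporal (X : Type*) where
  | top : NonTemporal X
  | pred (P : X → ℝ) : NonTemporal X
  | notPred (P : X → ℝ) : NonTemporal X
  | and (ψ₁ ψ₂ : NonTemporal X) : NonTemporal X

/-- Temporal formulas `G_[a,b] ψ`, `F_[a,b] ψ` and `F_[a₁,b₁] G_[a₂,b₂] ψ`. -/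
inductive Temporal (X : Type*) where
  | always (a b : ℝ) (ψ : NonTemporal X) : Temporal X
  | eventually (a b : ℝ) (ψ : NonTemporal X) : Temporal X
  | eventuallyAlways (a₁ b₁ a₂ b₂ : ℝ) (ψ : NonTemporal X) : Temporal X

variable {X : Type*}

/-- Truth of a non-temporal formula at a state. -/
def NonTemporal.Holds : NonTemporal X → X → Prop
  | .top, _ => True
  | .pred P, x => 0 ≤ P x
  | .notPred P, x => ¬ 0 ≤ P x
  | .and ψ₁ ψ₂, x => ψ₁.Holds x ∧ ψ₂.Holds x

/-- Exact robustness (`+∞` for `⊤`, minimum for conjunctions). -/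
noncomputable def NonTemporal.exactRobustness : NonTemporal X → X → EReal
  | .top, _ => ⊤
  | .pred P, x => ((P x : ℝ) : EReal)
  | .notPred P, x => ((-P x : ℝ) : EReal)
  | .and ψ₁ ψ₂, x => min (ψ₁.exactRobustness x) (ψ₂.exactRobustness x)

/-- The quantity `exp (-η ρ)`, where conjunctions are treated by the smooth minimum
`ρ = -(1/η) ln (exp (-η ρ₁) + exp (-η ρ₂))`, and `exp (-η ρ) = 0` for `⊤`. -/
noncomputable def NonTemporal.expSum (η : ℝ) : NonTemporal X → X → ℝ
  | .top, _ => 0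
  | .pred P, x => Real.exp (-η * P x)
  | .notPred P, x => Real.exp (-η * (-P x))
  | .and ψ₁ ψ₂, x => ψ₁.expSum η x + ψ₂.expSum η x

/-- Robustness used by the controller: the exact one for `none` (smoothing parameter `∞`), and the one
with smooth minimum of parameter `η` for `some η`. They agree on formulas that hold a single predicate. -/
noncomputable def NonTemporal.robustness (s : Option ℝ) (ψ : NonTemporal X) (x : X) : ℝ :=
  match s with
  | none => (ψ.exactRobustness x).toReal
  | some η => -(1 / η) * Real.log (ψ.expSum η x)

/-- The non-temporal formula inside a temporal one. -/
def Temporal.inner : Temporal X → NonTemporal X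
  | .always _ _ ψ => ψ
  | .eventually _ _ ψ => ψ
  | .eventuallyAlways _ _ _ _ ψ => ψ

/-- The time intervals of the formula are intervals of nonnegative reals. -/
def Temporal.WellFormed : Temporal X → Prop
  | .always a b _ => 0 ≤ a ∧ a ≤ b
  | .eventually a b _ => 0 ≤ a ∧ a ≤ b
  | .eventuallyAlways a₁ b₁ a₂ b₂ _ => (0 ≤ a₁ ∧ a₁ ≤ b₁) ∧ (0 ≤ a₂ ∧ a₂ ≤ b₂)

/-- Satisfaction of a temporal formula by the signal `x` at time `t`. -/
def Temporal.Sat : Temporal X → (ℝ → X) → ℝ → Prop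
  | .always a b ψ, x, t => ∀ t₁ ∈ Icc (t + a) (t + b), ψ.Holds (x t₁)
  | .eventually a b ψ, x, t => ∃ t₁ ∈ Icc (t + a) (t + b), ψ.Holds (x t₁)
  | .eventuallyAlways a₁ b₁ a₂ b₂ ψ, x, t =>
      ∃ t₁ ∈ Icc (t + a₁) (t + b₁), ∀ t₂ ∈ Icc (t₁ + a₂) (t₁ + b₂), ψ.Holds (x t₂)

/-- `tStar` is an admissible choice of the time at which an eventually operator is met. -/
def Temporal.AdmissibleTime : Temporal X → ℝ → Prop
  | .always _ _ _, _ => True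
  | .eventually a b _, tStar => tStar ∈ Icc a b
  | .eventuallyAlways a₁ b₁ _ _ _, tStar => tStar ∈ Icc a₁ b₁

/-- The time window over which the inner formula is enforced. -/
def Temporal.window : Temporal X → ℝ → Set ℝ
  | .always a b _, _ => Icc a b
  | .eventually _ _ _, tStar => {tStar}
  | .eventuallyAlways _ _ a₂ b₂ _, tStar => Icc (tStar + a₂) (tStar + b₂)

end Formulas

/-- Prescribed performance functions on `[0, ∞)`. -/
structure IsPPF (ρ : ℝ → ℝ) : Prop where
  contDiff : ContDiffOn ℝ 1 ρ (Ici 0)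
  pos : ∀ t, 0 ≤ t → 0 < ρ t
  bounded : ∃ B, ∀ t, 0 ≤ t → ρ t ≤ B
  deriv_bounded : ∃ B, ∀ t, 0 ≤ t → |derivWithin ρ (Ici 0) t| ≤ B

/-- A directed graph, given by its edge relation, has no directed cycle. -/
def Acyclic {α : Type*} (r : α → α → Prop) : Prop := ∀ a, ¬ Relation.TransGen r a a

/-- The global state `(x_i)_i`, with `x_i ∈ ℝ^(n i)`. -/
abbrev State {V : Type*} (n : V → ℕ) : Type _ := (i : V) → Fin (n i) → ℝ

/-- The estimates: `xhat j i` is the estimate of `x_i` carried out by agent `j`. Only the entries where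
`j` is a `k`-hop neighbor of `i` belong to the observer; no other entry is ever used. -/
abbrev Estimates {V : Type*} (n : V → ℕ) : Type _ := V → (i : V) → Fin (n i) → ℝ

/-- The data of the agents `ẋ_i = f_i(x_i) + g_i(x_i) u_i + w_i(x,t)`. -/
structure Agents {V : Type*} (n m : V → ℕ) where
  f : (i : V) → (Fin (n i) → ℝ) → (Fin (n i) → ℝ)
  g : (i : V) → (Fin (n i) → ℝ) → Matrix (Fin (n i)) (Fin (m i)) ℝ
  w : (i : V) → State n → ℝ → (Fin (n i) → ℝ)

/-- Standing assumptions on the agents: `f_i`, `g_i` locally Lipschitz, `g_i g_iᵀ` positive definite,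
`w_i` continuous and uniformly bounded on `ℝⁿ × [0, ∞)`. -/
structure Agents.Regular {V : Type*} {n m : V → ℕ} (A : Agents n m) : Prop where
  f_lipschitz : ∀ i, LocallyLipschitz (A.f i)
  g_lipschitz : ∀ i a b, LocallyLipschitz (fun y => A.g i y a b)
  g_posDef : ∀ i y, (A.g i y * (A.g i y).transpose).PosDef
  w_continuous : ∀ i, ContinuousOn (fun p : State n × ℝ => A.w i p.1 p.2) (univ ×ˢ Ici 0)
  w_bounded : ∀ i, ∃ B, ∀ x t, 0 ≤ t → ∀ a, |A.w i x t a| ≤ B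

/-- The local tasks `φ_i` of the agents, with the smoothing parameters of their robustness functions. -/
structure Spec {V : Type*} (n : V → ℕ) where
  task : V → Temporal (State n)
  smoothing : V → Option ℝ

/-- The design parameters of observer and controller. -/
structure Design {V : Type*} (n : V → ℕ) where
  /-- number of hops -/
  k : ℕ
  /-- `obsFunnel i j a` is the bound `ρ_i^j` on component `a` of the disagreement of `j` on `x_i` -/
  obsFunnel : (i : V) → V → Fin (n i) → ℝ → ℝ
  /-- `δ i j a` is the bound `δ_i^j` on component `a` of the error of the estimate of `x_i` by `j` -/
  δ : (i : V) → V → Fin (n i) → ℝ → ℝ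
  /-- task funnels `γ_{ψ_i}` -/
  γ : V → ℝ → ℝ
  /-- corrections `ρ^t_{ψ_i}` for the worst-case estimation error -/
  ρt : V → ℝ → ℝ
  /-- upper bounds `ρ^max_{ψ_i}` -/
  ρmax : V → ℝ
  /-- times at which the eventually operators are met -/
  tStar : V → ℝ

/-- The modified funnel `Γ_{ψ_i} = γ_{ψ_i} - ρ^t_{ψ_i}`. -/
def Design.Γ {V : Type*} {n : V → ℕ} (D : Design n) (i : V) (t : ℝ) : ℝ := D.γ i t - D.ρt i t

section Graphs

variable {V : Type*}

/-- The `k`-hop neighbors of `i`: the agents at distance between `2` and `k` in the communication graph. -/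
def kHop (G : SimpleGraph V) (k : ℕ) (i : V) : Set V := {j | 2 ≤ G.dist i j ∧ G.dist i j ≤ k}

noncomputable instance kHopFintype [Fintype V] (G : SimpleGraph V) (k : ℕ) (i : V) : Fintype (kHop G k i) :=
  Fintype.ofFinite _

open Classical in
/-- The matrix `M_i = L_i + H_i`: Laplacian of the subgraph induced by the `k`-hop neighbors of `i`, plus
the diagonal matrix of the numbers of neighbors that the `k`-hop neighbors share with `i`. -/
noncomputable def obsMatrix [Fintype V] [DecidableEq V] (G : SimpleGraph V) (k : ℕ) (i : V) :
    Matrix (kHop G k i) (kHop G k i) ℝ :=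
  (G.induce (kHop G k i)).lapMatrix ℝ +
    Matrix.diagonal (fun j : kHop G k i => ((G.neighborSet j ∩ G.neighborSet i).ncard : ℝ))

variable {n : V → ℕ}

/-- `ρ^{ψ_i}`, as a function of the global state. -/
noncomputable def Spec.rho (Φ : Spec n) (i : V) : State n → ℝ :=
  (Φ.task i).inner.robustness (Φ.smoothing i)

/-- Edges `(i, j)` of the task graph: the robustness of the task of `i` depends on `x_j`. -/
def Spec.TaskEdge [DecidableEq V] (Φ : Spec n) (i j : V) : Prop :=
  ∃ (x : State n) (v : Fin (n j) → ℝ), Φ.rho i (Function.update x j v) ≠ Φ.rho i x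

/-- The task neighborhood of `i`, which contains `i`. -/
def Spec.taskNbhd [DecidableEq V] (Φ : Spec n) (i : V) : Set V := {j | Φ.TaskEdge i j ∨ j = i}

/-- The agents whose state is needed for the task of `i`, but is not communicated to `i`. -/
def Spec.estimated [DecidableEq V] (Φ : Spec n) (G : SimpleGraph V) (i : V) : Set V :=
  {j | j ∈ Φ.taskNbhd i ∧ j ≠ i ∧ ¬ G.Adj i j}

/-- The intersection of communication graph and task graph, orientation forgotten. -/
def Spec.commTaskGraph [DecidableEq V] (Φ : Spec n) (G : SimpleGraph V) : SimpleGraph V :=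
  G ⊓ SimpleGraph.fromRel Φ.TaskEdge

/-- Clusters: the connected components of the intersection graph. -/
abbrev Spec.Cluster [DecidableEq V] (Φ : Spec n) (G : SimpleGraph V) : Type _ :=
  (Φ.commTaskGraph G).ConnectedComponent

/-- The cluster of an agent. -/
def Spec.clusterOf [DecidableEq V] (Φ : Spec n) (G : SimpleGraph V) (i : V) : Φ.Cluster G :=
  (Φ.commTaskGraph G).connectedComponentMk i

/-- Edges of the cluster-induced graph. -/
def Spec.ClusterEdge [DecidableEq V] (Φ : Spec n) (G : SimpleGraph V) (C C' : Φ.Cluster G) : Prop :=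
  C ≠ C' ∧ ∃ i j, Φ.clusterOf G i = C ∧ Φ.clusterOf G j = C' ∧ Φ.TaskEdge i j

/-- Satisfaction of the task `φ^c_l` of a cluster, the conjunction of the tasks of its agents. -/
def Spec.ClusterSat [DecidableEq V] (Φ : Spec n) (G : SimpleGraph V) (l : Φ.Cluster G)
    (x : ℝ → State n) : Prop :=
  ∀ i, Φ.clusterOf G i = l → (Φ.task i).Sat x 0

/-- Satisfaction of the global task `φ`, the conjunction of all local tasks. -/
def Spec.GlobalSat (Φ : Spec n) (x : ℝ → State n) : Prop := ∀ i, (Φ.task i).Sat x 0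

end Graphs

section ClosedLoop

variable {V : Type*} [Fintype V] [DecidableEq V] {n m : V → ℕ}

/-- Partial derivative of a function of the global state with respect to component `a` of `x_i`. -/
noncomputable def partialDeriv (F : State n → ℝ) (i : V) (a : Fin (n i)) (x : State n) : ℝ :=
  fderiv ℝ F x (Pi.single i (Pi.single a 1))

open Classical in
/-- Component `a` of the disagreement `ξ_i^j` of agent `j` on `x_i`. -/
noncomputable def disagreement (G : SimpleGraph V) (k : ℕ) (x : State n) (xhat : Estimates n)
    (i j : V) (a : Fin (n i)) : ℝ :=
  (∑ l with G.Adj j l ∧ l ∈ kHop G k i, (xhat j i a - xhat l i a)) +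
    ((G.neighborSet j ∩ G.neighborSet i).ncard : ℝ) * (xhat j i a - x i a)

/-- The normalized disagreement `e_i^j = ξ_i^j / ρ_i^j(t)`, component `a`. -/
noncomputable def normDisagreement (G : SimpleGraph V) (D : Design n) (t : ℝ) (x : State n)
    (xhat : Estimates n) (i j : V) (a : Fin (n i)) : ℝ :=
  (D.obsFunnel i j a t)⁻¹ * disagreement G D.k x xhat i j a

/-- Derivative `J_T(e) = 2/(1-e²)` of the transformation `T(e) = ln ((1+e)/(1-e))`. -/
noncomputable def obsJac (e : ℝ) : ℝ := 2 / (1 - e ^ 2)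

/-- The transformation `T(e) = ln ((1+e)/(1-e))` of the observer, meant for `-1 < e < 1`. -/
noncomputable def obsTrans (e : ℝ) : ℝ := Real.log ((1 + e) / (1 - e))

/-- Right-hand side `-ρ⁻¹ J_T(e) T(e)` of the observer: component `a` of the derivative of the estimate of
`x_i` by `j`. -/
noncomputable def observerRate (G : SimpleGraph V) (D : Design n) (t : ℝ) (x : State n)
    (xhat : Estimates n) (i j : V) (a : Fin (n i)) : ℝ :=
  -((D.obsFunnel i j a t)⁻¹ * obsJac (normDisagreement G D t x xhat i j a) *
    obsTrans (normDisagreement G D t x xhat i j a))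

open Classical in
/-- The vector on which agent `i` evaluates its robustness: true states, except for the estimates of the
states that are needed for the task of `i` but not communicated to `i`. -/
noncomputable def taskState (Φ : Spec n) (G : SimpleGraph V) (x : State n) (xhat : Estimates n)
    (i : V) : State n :=
  fun j => if j ∈ Φ.estimated G i then xhat i j else x j

/-- The normalized error `e^{ψ_i}`. -/
noncomputable def normError (Φ : Spec n) (G : SimpleGraph V) (D : Design n) (t : ℝ) (x : State n)
    (xhat : Estimates n) (i : V) : ℝ :=
  (D.Γ i t)⁻¹ * (Φ.rho i (taskState Φ G x xhat i) - D.ρmax i)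

/-- Derivative `J(e) = -1/(e (e+1))` of the transformation `T(e) = ln (-(e+1)/e)`. -/
noncomputable def taskJac (e : ℝ) : ℝ := -1 / (e * (e + 1))

/-- The transformation `T(e) = ln (-(e+1)/e)` of the controller, meant for `-1 < e < 0`. -/
noncomputable def taskTrans (e : ℝ) : ℝ := Real.log (-(e + 1) / e)

open Classical in
/-- The feedback law `u_i = -g_i(x_i)ᵀ ∑_j (∂ρ^{ψ_j}/∂x_i) Γ_j⁻¹ J_j ε_j`, the sum over the agents `j` in
the cluster of `i`, where `J_j` and `ε_j` are `taskJac` and `taskTrans` of the normalized error of `j`. -/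
noncomputable def controlInput (A : Agents n m) (Φ : Spec n) (G : SimpleGraph V) (D : Design n) (t : ℝ)
    (x : State n) (xhat : Estimates n) (i : V) : Fin (m i) → ℝ :=
  -((A.g i (x i)).transpose.mulVec fun a =>
    ∑ j with Φ.clusterOf G j = Φ.clusterOf G i,
      partialDeriv (Φ.rho j) i a (taskState Φ G x xhat j) * (D.Γ j t)⁻¹ *
        taskJac (normError Φ G D t x xhat j) * taskTrans (normError Φ G D t x xhat j))

/-- Solutions of the closed loop of agents, observers and controllers on a time set `I ⊆ [0, ∞)`. -/
structure IsSolution (A : Agents n m) (Φ : Spec n) (G : SimpleGraph V) (D : Design n) (I : Set ℝ)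
    (x : ℝ → State n) (xhat : ℝ → Estimates n) : Prop where
  agents : ∀ t ∈ I, ∀ i, HasDerivWithinAt (fun s => x s i)
    (A.f i (x t i) + (A.g i (x t i)).mulVec (controlInput A Φ G D t (x t) (xhat t) i)
      + A.w i (x t) t) (Ici 0) t
  observers : ∀ t ∈ I, ∀ i, ∀ j ∈ kHop G D.k i, ∀ a,
    HasDerivWithinAt (fun s => xhat s j i a) (observerRate G D t (x t) (xhat t) i j a) (Ici 0) t

/-- All robustness values and all disagreements are strictly inside their funnels at time `t`, so that
observers and controllers are well defined. -/
structure InFunnels (Φ : Spec n) (G : SimpleGraph V) (D : Design n) (t : ℝ) (x : State n)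
    (xhat : Estimates n) : Prop where
  task : ∀ i, -D.Γ i t < Φ.rho i (taskState Φ G x xhat i) - D.ρmax i ∧
    Φ.rho i (taskState Φ G x xhat i) - D.ρmax i < 0
  observer : ∀ i, ∀ j ∈ kHop G D.k i, ∀ a,
    |disagreement G D.k x xhat i j a| < D.obsFunnel i j a t

/-- Assumptions on the robustness function `ρ^{ψ_i}`. -/
structure GoodRobustness (Φ : Spec n) (i : V) : Prop where
  concave : ConcaveOn ℝ univ (Φ.rho i)
  /-- continuously differentiable, except possibly where the global maximum is attained -/
  smooth : ∀ x, ¬ IsMaxOn (Φ.rho i) univ x → ContDiffAt ℝ 1 (Φ.rho i) x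
  /-- the gradient with respect to `x_i` vanishes at global maximum points only -/
  gradient : ∀ x, (∀ a, partialDeriv (Φ.rho i) i a x = 0) → IsMaxOn (Φ.rho i) univ x
  /-- well-posedness: on superlevel sets, `x_i` is bounded in terms of a bound on the states of the other
  agents in the task -/
  wellPosed : ∀ C R : ℝ, ∃ B : ℝ, ∀ x : State n, C ≤ Φ.rho i x →
    (∀ j ∈ Φ.taskNbhd i, j ≠ i → ∀ a, |x j a| ≤ R) → ∀ a, |x i a| ≤ B

/-- The specification is an admissible one for the communication graph: well-formed tasks, acyclic task
graph (self-loops are allowed), task neighbors within a cluster communicate, acyclic cluster-induced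
graph, and the assumptions on the robustness functions. -/
structure Spec.Admissible (Φ : Spec n) (G : SimpleGraph V) : Prop where
  wellFormed : ∀ i, (Φ.task i).WellFormed
  smoothing_pos : ∀ i, ∀ η ∈ Φ.smoothing i, 0 < η
  acyclic : Acyclic fun i j => i ≠ j ∧ Φ.TaskEdge i j
  cluster_comm : ∀ i, ∀ j ∈ Φ.taskNbhd i, Φ.clusterOf G j = Φ.clusterOf G i → j = i ∨ G.Adj i j
  cluster_acyclic : Acyclic (Φ.ClusterEdge G)
  robustness : ∀ i, GoodRobustness Φ i

/-- Requirements on the design of the observers. -/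
structure Design.ObserverOK (D : Design n) (Φ : Spec n) (G : SimpleGraph V) : Prop where
  /-- the number of hops reaches every agent that has to be estimated -/
  hops : ∀ i, ∀ j ∈ Φ.estimated G i, G.dist i j ≤ D.k
  obsFunnel_ppf : ∀ i, ∀ j ∈ kHop G D.k i, ∀ a, IsPPF (D.obsFunnel i j a)
  δ_ppf : ∀ i, ∀ j ∈ kHop G D.k i, ∀ a, IsPPF (D.δ i j a)
  /-- `∑_r |(M_i⁻¹)_{j,r}| ρ_i^r(t) ≤ δ_i^j(t)` -/
  compat : ∀ (i : V) (j : kHop G D.k i) (a : Fin (n i)) (t : ℝ), 0 ≤ t →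
    (∑ r : kHop G D.k i, |(obsMatrix G D.k i)⁻¹ j r| * D.obsFunnel i r a t) ≤ D.δ i j a t

/-- Requirements on the design of the task funnels. -/
structure Design.FunnelsOK (D : Design n) (Φ : Spec n) (G : SimpleGraph V) : Prop where
  tStar_mem : ∀ i, (Φ.task i).AdmissibleTime (D.tStar i)
  γ_ppf : ∀ i, IsPPF (D.γ i)
  γ_window : ∀ i, ∀ t ∈ (Φ.task i).window (D.tStar i), 0 < -D.γ i t + D.ρmax i
  /-- `0 < ρ^max_{ψ_i} < sup ρ^{ψ_i}` -/
  ρmax_pos : ∀ i, 0 < D.ρmax i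
  ρmax_lt : ∀ i, ∃ x, D.ρmax i < Φ.rho i x
  /-- the correction is a prescribed performance function, or zero for tasks without estimates -/
  ρt_ppf : ∀ i, IsPPF (D.ρt i) ∨ (Φ.estimated G i = ∅ ∧ ∀ t, 0 ≤ t → D.ρt i t = 0)
  /-- for estimation errors within the bounds `δ`, positivity of the corrected robustness at the
  estimates implies positivity of the robustness at the true states -/
  ρt_spec : ∀ i t, 0 ≤ t → ∀ (x : State n) (xhat : Estimates n),
    (∀ j ∈ Φ.estimated G i, ∀ a, |xhat i j a - x j a| < D.δ j i a t) →
    0 < Φ.rho i (taskState Φ G x xhat i) - D.ρt i t → 0 < Φ.rho i x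
  Γ_pos : ∀ i t, 0 ≤ t → 0 < D.Γ i t
  ρt_lt_ρmax : ∀ i, ∀ t ∈ (Φ.task i).window (D.tStar i), D.ρt i t < D.ρmax i
  /-- some global state has `ρ^{ψ_i} > max_{window} ρ^t_{ψ_i}` for all `i` -/
  feasible : ∃ x, ∀ i, ∀ t ∈ (Φ.task i).window (D.tStar i), D.ρt i t < Φ.rho i x

end ClosedLoop

end STLControl

/-! The closed loop is an ODE with a right-hand side that is continuous on the open set where all
normalized errors lie strictly inside their funnels. It contains gradients of robustness functions,
which are only continuous, so existence comes from Peano's theorem (`exists_local_solution`) and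
every a priori bound is proved for an arbitrary solution. By `SolvesOn.exists_global_of_trapped` it
suffices that a solution inside the funnels on `[0, T)` has bounded velocity and cannot tend to a
funnel boundary as `t → T`; this is `closedLoop_trapped`.

Inside the funnels the states are bounded: the lower funnel bound puts each agent on a superlevel
set of its robustness, and well-posedness passes bounds along the acyclic task graph
(`absBoundedOn_state`). Transformed errors `ε` are controlled by the potential `½ ∑ ε²`, summed over
a cluster, or over the observers of one component of a state. If `z` is the gradient of this
potential in the unnormalized errors, its derivative along a solution is at most `-c ∑ z² + 2B ∑
|z|`, hence bounded, and so is `ε` on `[0, T)` (`exists_bound_transformed_error`). For observers the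
dissipation is the quadratic form of `M_i`, positive definite since `G` is connected
(`obsMatrix_quadratic_pos`). For controllers it is `∑ ‖g_lᵀ v_l‖²` with `v_l = ∑ z_j ∂ρ_j/∂x_l`.
Acyclicity makes the map from `z` to `v` block triangular with nonzero diagonal blocks, so the form
is definite (`eq_zero_of_clusterGradient_eq_zero`), uniformly so by compactness
(`exists_feedbackPower_lower_bound`).

The task errors of a cluster need bounded velocities of the estimates it uses, and these need
bounded velocities of the estimated agents. Those agents lie in other clusters, so induction along
the acyclic cluster-induced graph avoids circularity (`absBoundedOn_transformed_errors`).

Satisfaction is then algebra: the errors are below `δ` by inverting `M_i`, and on the window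
`ρ_i(x̂) > ρmax - γ + ρt > ρt`, which forces `ρ_i(x) > 0` (`InFunnels.holds`). -/

namespace STLControl

/-! ### Peano existence and continuation of solutions -/

section ODE

open Filter Topology

variable {E : Type*} [NormedAddCommGroup E] [NormedSpace ℝ E]

/-- Nodes of the explicit Euler scheme with step `h`. -/
noncomputable def eulerNode (F : ℝ → E → E) (h : ℝ) (p₀ : E) : ℕ → E
  | 0 => p₀
  | k + 1 => eulerNode F h p₀ k + h • F (k * h) (eulerNode F h p₀ k)

/-- Each Euler step deviates from `h • v` by at most `h * ε`, and the deviations add up. The case `v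
= 0` gives a Lipschitz bound on the scheme; `v = F t₀ (p t₀)` gives the derivative of the limit. -/
lemma norm_eulerNode_sub_sub_le {F : ℝ → E → E} {h : ℝ} (hh : 0 ≤ h) {p₀ v : E} {ε : ℝ} {i j : ℕ}
    (hij : i ≤ j)
    (H : ∀ k, i ≤ k → k < j → ‖F (k * h) (eulerNode F h p₀ k) - v‖ ≤ ε) :
    ‖eulerNode F h p₀ j - eulerNode F h p₀ i - (((j : ℝ) - i) * h) • v‖ ≤ ((j : ℝ) - i) * h * ε := by
  induction j, hij using Nat.le_induction with
  | base => simp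
  | succ j hij ih =>
    have h1 := ih fun k hk hkj => H k hk (by omega)
    have h2 := H j hij (by omega)
    have h3 : eulerNode F h p₀ (j + 1) - eulerNode F h p₀ i - (((j + 1 : ℕ) : ℝ) - i) • h • v
        = (eulerNode F h p₀ j - eulerNode F h p₀ i - (((j : ℝ) - i) * h) • v)
          + h • (F (j * h) (eulerNode F h p₀ j) - v) := by
      simp only [eulerNode]
      push_cast
      module
    rw [mul_smul, h3]
    refine (norm_add_le _ _).trans ?_
    rw [norm_smul, Real.norm_of_nonneg hh]
    push_cast
    nlinarith [mul_le_mul_of_nonneg_left h2 hh]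

lemma norm_eulerNode_sub_le {F : ℝ → E → E} {h : ℝ} (hh : 0 ≤ h) {p₀ : E} {M : ℝ}
    (hM : ∀ t p, 0 ≤ t → ‖F t p‖ ≤ M) (i j : ℕ) :
    ‖eulerNode F h p₀ j - eulerNode F h p₀ i‖ ≤ |(j : ℝ) * h - i * h| * M := by
  wlog hij : i ≤ j generalizing i j
  · rw [norm_sub_rev, abs_sub_comm]
    exact this j i (by omega)
  have := norm_eulerNode_sub_sub_le (F := F) hh (p₀ := p₀) (v := 0) hij
    (fun k _ _ => by simpa using hM (k * h) (eulerNode F h p₀ k) (by positivity))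
  rw [← sub_mul, abs_of_nonneg (mul_nonneg (by simpa using hij) hh)]
  simpa using this

/-- **Peano's theorem**, global version for bounded continuous vector fields. -/
theorem exists_solution_of_bounded [ProperSpace E] {F : ℝ → E → E} {M : ℝ}
    (hF : ContinuousOn (fun z : ℝ × E => F z.1 z.2) (Ici 0 ×ˢ univ))
    (hM : ∀ t p, 0 ≤ t → ‖F t p‖ ≤ M) (p₀ : E) :
    ∃ p : ℝ → E, p 0 = p₀ ∧ ∀ t, 0 ≤ t → HasDerivWithinAt p (F t (p t)) (Ici 0) t := by
  have hM0 : 0 ≤ M := (norm_nonneg _).trans (hM 0 p₀ le_rfl)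
  -- The solution is the pointwise limit of Euler schemes along one fixed ultrafilter. Compactness
  -- of balls gives the limit at each time separately, so no uniformly convergent subsequence has to
  -- be extracted.
  let U : Ultrafilter ℕ := hyperfilter ℕ
  have hU : (U : Filter ℕ) ≤ atTop := by
    rw [← Nat.cofinite_eq_atTop]; exact hyperfilter_le_cofinite
  let h : ℕ → ℝ := fun n => 1 / ((n : ℝ) + 1)
  have hh : ∀ n, 0 < h n := fun n => by positivity
  have hlim : Tendsto h U (𝓝 0) := tendsto_one_div_add_atTop_nhds_zero_nat.mono_left hU
  let J : ℕ → ℝ → ℕ := fun n t => ⌊t * ((n : ℝ) + 1)⌋₊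
  let P : ℕ → ℝ → E := fun n t => eulerNode F (h n) p₀ (J n t)
  have hJle : ∀ n t, 0 ≤ t → (J n t : ℝ) * h n ≤ t := fun n t ht => by
    have : (J n t : ℝ) ≤ t * (n + 1) := Nat.floor_le (by positivity)
    calc (J n t : ℝ) * h n ≤ (t * (n + 1)) * h n := by gcongr
      _ = t := by simp only [h]; field_simp
  have hJge : ∀ n t, t ≤ (J n t : ℝ) * h n + h n := fun n t => by
    have : t * (n + 1) < (J n t : ℝ) + 1 := Nat.lt_floor_add_one _
    calc t = (t * (n + 1)) * h n := by simp only [h]; field_simp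
      _ ≤ ((J n t : ℝ) + 1) * h n := by gcongr
      _ = _ := by ring
  have hJlim : ∀ t, 0 ≤ t → Tendsto (fun n => (J n t : ℝ) * h n) U (𝓝 t) := fun t ht => by
    have h1 : Tendsto (fun n => t - h n) U (𝓝 t) := by simpa using hlim.const_sub t
    exact tendsto_of_tendsto_of_tendsto_of_le_of_le h1 tendsto_const_nhds
      (fun n => by have := hJge n t; simp only; linarith) (fun n => hJle n t ht)
  have hex : ∀ t, ∃ q, 0 ≤ t → Tendsto (fun n => P n t) U (𝓝 q) := fun t => by
    by_cases ht : 0 ≤ t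
    · have hmem : ∀ n, P n t ∈ Metric.closedBall p₀ (t * M) := fun n => by
        have := norm_eulerNode_sub_le (F := F) (hh n).le (p₀ := p₀) hM 0 (J n t)
        rw [Metric.mem_closedBall, dist_eq_norm]
        refine this.trans ?_
        have h0 : (0 : ℝ) ≤ (J n t : ℝ) * h n := by have := (hh n).le; positivity
        simp only [Nat.cast_zero, zero_mul, sub_zero, abs_of_nonneg h0]
        exact mul_le_mul_of_nonneg_right (hJle n t ht) hM0
      obtain ⟨q, -, hq⟩ := (isCompact_closedBall p₀ (t * M)).ultrafilter_le_nhds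
        (U.map fun n => P n t) (by
          rw [le_principal_iff]; exact mem_map.2 (univ_mem' hmem))
      exact ⟨q, fun _ => hq⟩
    · exact ⟨p₀, fun h => absurd h ht⟩
  choose p hp using hex
  refine ⟨p, ?_, fun t₀ ht₀ => ?_⟩
  · refine tendsto_nhds_unique (hp 0 le_rfl) ?_
    have : (fun n => P n 0) = fun _ => p₀ := by
      funext n
      simp [P, J, eulerNode]
    rw [this]
    exact tendsto_const_nhds
  set v := F t₀ (p t₀) with hv
  -- it suffices to control increments near `t₀`
  have key : ∀ ε > 0, ∃ δ > 0, ∀ s t, 0 ≤ s → s ≤ t → |s - t₀| < δ → |t - t₀| < δ →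
      ‖p t - p s - (t - s) • v‖ ≤ (t - s) * ε := by
    intro ε hε
    obtain ⟨η, hη, hFη⟩ := Metric.continuousWithinAt_iff.1 (hF (t₀, p t₀) ⟨ht₀, mem_univ _⟩) ε hε
    have hη' : 0 < η / (4 * (M + 1)) := by positivity
    -- For this radius `δ` both `δ` and `δ * M` are at most `η / 4`. With `h n < δ / 2`, a node
    -- between the times `s` and `t` is within `2 * δ * M ≤ η / 2` of the node at `t₀`, which is
    -- eventually within `η / 2` of `p t₀`. Hence the field at such nodes is `ε`-close to `v`.
    refine ⟨η / (4 * (M + 1)), hη', fun s t hs hst hsδ htδ => ?_⟩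
    have ht : 0 ≤ t := hs.trans hst
    have hδη : η / (4 * (M + 1)) ≤ η / 4 := by
      gcongr; linarith
    have hδM : η / (4 * (M + 1)) * M ≤ η / 4 := by
      rw [div_mul_eq_mul_div, div_le_div_iff₀ (by positivity) (by positivity)]
      nlinarith
    have ev1 : ∀ᶠ n in U, h n < η / (8 * (M + 1)) :=
      hlim.eventually (gt_mem_nhds (by positivity))
    have ev2 : ∀ᶠ n in U, dist (P n t₀) (p t₀) < η / 2 :=
      (hp t₀ ht₀).eventually (Metric.ball_mem_nhds _ (by positivity))
    have ev : ∀ᶠ n in U, ‖P n t - P n s - ((J n t : ℝ) * h n - J n s * h n) • v‖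
        ≤ ((J n t : ℝ) * h n - J n s * h n) * ε := by
      filter_upwards [ev1, ev2] with n hn1 hn2
      have e8 : η / (8 * (M + 1)) = η / (4 * (M + 1)) / 2 := by field_simp; norm_num
      rw [e8] at hn1
      have hmono : J n s ≤ J n t := Nat.floor_mono (by gcongr)
      have := norm_eulerNode_sub_sub_le (F := F) (hh n).le (p₀ := p₀) (v := v) (ε := ε) hmono ?_
      · simpa only [sub_mul] using this
      intro k hk1 hk2
      have c1 : (J n s : ℝ) * h n ≤ k * h n := by
        have := (hh n).le; gcongr
      have c2 : (k : ℝ) * h n ≤ J n t * h n := by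
        have := (hh n).le; gcongr
      have c3 := hJge n s
      have c4 := hJle n t ht
      have c5 : |(k : ℝ) * h n - t₀| < η / (4 * (M + 1)) + h n := by
        rw [abs_lt] at *; constructor <;> linarith [hh n]
      have c6 : |(k : ℝ) * h n - J n t₀ * h n| ≤ η / (4 * (M + 1)) + 2 * h n := by
        have := hJge n t₀
        have := hJle n t₀ ht₀
        rw [abs_lt] at c5; rw [abs_le]; constructor <;> linarith [hh n]
      have c7 := norm_eulerNode_sub_le (F := F) (hh n).le (p₀ := p₀) hM (J n t₀) k
      have c8 : ‖eulerNode F (h n) p₀ k - P n t₀‖ ≤ η / 2 := by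
        refine c7.trans ((mul_le_mul_of_nonneg_right c6 hM0).trans ?_)
        nlinarith [mul_le_mul_of_nonneg_right hn1.le hM0]
      have hk0 : (0 : ℝ) ≤ k * h n := by have := (hh n).le; positivity
      have := hFη (x := ((k : ℝ) * h n, eulerNode F (h n) p₀ k)) ⟨hk0, mem_univ _⟩ ?_
      · rw [dist_eq_norm] at this; exact this.le
      rw [Prod.dist_eq, max_lt_iff]
      constructor
      · simp only [Real.dist_eq]
        linarith
      · simp only
        calc dist (eulerNode F (h n) p₀ k) (p t₀) ≤ dist (eulerNode F (h n) p₀ k) (P n t₀)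
              + dist (P n t₀) (p t₀) := dist_triangle _ _ _
          _ < η / 2 + η / 2 := by rw [dist_eq_norm]; exact add_lt_add_of_le_of_lt c8 hn2
          _ = η := by ring
    have l1 := (hJlim t ht).sub (hJlim s hs)
    have l2 := (((hp t ht).sub (hp s hs)).sub (l1.smul_const v)).norm
    exact le_of_tendsto_of_tendsto l2 (l1.mul_const ε) ev
  rw [hasDerivWithinAt_iff_isLittleO, Asymptotics.isLittleO_iff]
  intro ε hε
  obtain ⟨δ, hδ, H⟩ := key ε hε
  have : ∀ᶠ t in 𝓝[Ici 0] t₀, |t - t₀| < δ ∧ 0 ≤ t :=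
    (eventually_nhdsWithin_of_eventually_nhds (by
      filter_upwards [Metric.ball_mem_nhds t₀ hδ] with t ht
      simpa [Real.dist_eq] using ht)).and self_mem_nhdsWithin
  filter_upwards [this] with t ⟨h1, h2⟩
  rcases le_total t₀ t with h3 | h3
  · have := H t₀ t ht₀ h3 (by simpa using hδ) h1
    rw [Real.norm_of_nonneg (sub_nonneg.2 h3), mul_comm]
    exact this
  · have := H t t₀ h2 h3 h1 (by simpa using hδ)
    rw [Real.norm_eq_abs, abs_sub_comm, abs_of_nonneg (sub_nonneg.2 h3), mul_comm, ← norm_neg]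
    refine le_of_eq_of_le ?_ this
    congr 1
    module

/-- **Peano's theorem**, local version. -/
theorem exists_local_solution [FiniteDimensional ℝ E] {F : ℝ → E → E} {U : Set (ℝ × E)}
    (hU : IsOpen U) (hF : ContinuousOn (fun z : ℝ × E => F z.1 z.2) U) {T : ℝ} {q : E}
    (hq : (T, q) ∈ U) :
    ∃ δ > 0, ∃ p : ℝ → E, p T = q ∧
      ∀ t ∈ Ico T (T + δ), HasDerivWithinAt p (F t (p t)) (Ici T) t ∧ (t, p t) ∈ U := by
  have : ProperSpace E := FiniteDimensional.proper_real E
  obtain ⟨r', hr', hball⟩ := Metric.nhds_basis_closedBall.mem_iff.1 (hU.mem_nhds hq)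
  set c : ℝ × E := (T, q)
  obtain ⟨r, hr, rfl⟩ : ∃ r, 0 < r ∧ 2 * r = r' := ⟨r' / 2, by positivity, by ring⟩
  -- Tietze extension from a closed ball inside `U`, then multiplication by the cutoff `χ`, yields a
  -- bounded continuous field that equals `F` on the ball of radius `r`. Its global solution,
  -- shifted in time by `T`, solves the original equation while it stays in that ball.
  obtain ⟨H, hH⟩ := ContinuousMap.exists_restrict_eq (Y := E)
    (Metric.isClosed_closedBall (x := c) (ε := 2 * r))
    ⟨(Metric.closedBall c (2 * r)).domRestrict (fun z : ℝ × E => F z.1 z.2),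
      (hF.mono hball).domRestrict⟩
  have hH' : ∀ z ∈ Metric.closedBall c (2 * r), H z = F z.1 z.2 := fun z hz => by
    have := congrArg (fun f => f ⟨z, hz⟩) hH
    simpa using this
  let χ : ℝ × E → ℝ := fun z => max 0 (min 1 (2 - dist z c / r))
  have hχ : Continuous χ := by fun_prop
  have hχ1 : ∀ z ∈ Metric.closedBall c r, χ z = 1 := fun z hz => by
    have : dist z c / r ≤ 1 := (div_le_one hr).2 hz
    simp only [χ]
    rw [min_eq_left (by linarith), max_eq_right zero_le_one]
  have hχ0 : ∀ z ∉ Metric.closedBall c (2 * r), χ z = 0 := fun z hz => by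
    have : 2 ≤ dist z c / r := by
      rw [le_div_iff₀ hr]; simpa using (not_le.1 hz).le
    simp only [χ]
    rw [min_eq_right (by linarith), max_eq_left (by linarith)]
  have hK : Continuous fun z => χ z • H z := hχ.smul H.continuous
  obtain ⟨M, hM⟩ := (HasCompactSupport.intro (isCompact_closedBall c (2 * r)) fun z hz => by
    rw [hχ0 z hz, zero_smul]).exists_bound_of_continuous hK
  obtain ⟨y, hy0, hy⟩ := exists_solution_of_bounded
    (F := fun t x => χ (t + T, x) • H (t + T, x)) (M := M)
    (Continuous.continuousOn (hK.comp (by fun_prop : Continuous fun z : ℝ × E => (z.1 + T, z.2))))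
    (fun t x _ => hM _) q
  have hcont : ContinuousWithinAt (fun s => (s + T, y s)) (Ici 0) 0 :=
    ContinuousWithinAt.prodMk (by fun_prop) (hy 0 le_rfl).continuousWithinAt
  have hev : ∀ᶠ s in 𝓝[≥] (0 : ℝ), (s + T, y s) ∈ Metric.closedBall c r := by
    refine hcont.eventually_mem ?_
    simpa [hy0, c] using Metric.closedBall_mem_nhds c hr
  obtain ⟨δ, hδ, hδ'⟩ := mem_nhdsGE_iff_exists_Ico_subset.1 hev
  refine ⟨δ, hδ, fun t => y (t - T), by simp [hy0], fun t ht => ?_⟩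
  have hmem : (t, y (t - T)) ∈ Metric.closedBall c r := by
    have : t - T ∈ Ico 0 δ := ⟨by linarith [ht.1], by linarith [ht.2]⟩
    simpa using hδ' this
  have hmem2 := Metric.closedBall_subset_closedBall (by linarith : r ≤ 2 * r) hmem
  refine ⟨?_, hball hmem2⟩
  have h1 := hy (t - T) (by linarith [ht.1])
  simp only [sub_add_cancel, hχ1 _ hmem, one_smul, hH' _ hmem2] at h1
  have := h1.scomp t ((hasDerivWithinAt_id t (Ici T)).sub_const T) (fun s hs => by
    simpa using hs)
  simpa [Function.comp_def] using this

/-- Solutions of `p' = F(t, p)` on a set of nonnegative times. -/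
def SolvesOn (F : ℝ → E → E) (I : Set ℝ) (p : ℝ → E) : Prop :=
  ∀ t ∈ I, HasDerivWithinAt p (F t (p t)) (Ici 0) t

lemma SolvesOn.mono {F : ℝ → E → E} {I I' : Set ℝ} {p : ℝ → E} (h : SolvesOn F I p) (hI : I' ⊆ I) :
    SolvesOn F I' p := fun t ht => h t (hI ht)

/-- A solution with bounded velocity has a limit at the end of its interval. -/
lemma SolvesOn.exists_tendsto [FiniteDimensional ℝ E] {F : ℝ → E → E} {T : ℝ} {p : ℝ → E}
    (h : SolvesOn F (Ico 0 T) p) {B : ℝ} (hB : ∀ t ∈ Ico 0 T, ‖F t (p t)‖ ≤ B) :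
    ∃ q, Tendsto p (𝓝[Ico 0 T] T) (𝓝 q) := by
  have hlip : LipschitzOnWith (Real.toNNReal B) p (Ico 0 T) := by
    refine (convex_Ico 0 T).lipschitzOnWith_of_nnnorm_hasDerivWithin_le
      (fun t ht => (h t ht).mono Ico_subset_Ici_self) fun t ht => ?_
    rw [← NNReal.coe_le_coe, coe_nnnorm]
    exact (hB t ht).trans (Real.le_coe_toNNReal B)
  -- A Lipschitz extension to the whole line is continuous at `T`, so its value there is the limit.
  obtain ⟨g, hg, hEq⟩ := hlip.extend_finite_dimension
  exact ⟨g T, (hg.continuous.tendsto T).mono_left nhdsWithin_le_nhds |>.congr'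
    (eventually_nhdsWithin_of_forall fun t ht => (hEq ht).symm)⟩

/-- A solution that has a limit in the open domain of the vector field can be continued. -/
lemma SolvesOn.exists_extension [FiniteDimensional ℝ E] {F : ℝ → E → E} {U : Set (ℝ × E)}
    (hU : IsOpen U) (hF : ContinuousOn (fun z : ℝ × E => F z.1 z.2) U) {T : ℝ} (hT : 0 < T)
    {p : ℝ → E} (hp : SolvesOn F (Ico 0 T) p)
    {q : E} (hlim : Tendsto p (𝓝[Ico 0 T] T) (𝓝 q)) (hq : (T, q) ∈ U) :
    ∃ δ > 0, ∃ y : ℝ → E, SolvesOn F (Ico 0 (T + δ)) y ∧ EqOn y p (Ico 0 T) := by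
  obtain ⟨δ, hδ, z, hzT, hz⟩ := exists_local_solution hU hF hq
  let y : ℝ → E := fun t => if t < T then p t else z t
  have hyp : ∀ t, t < T → y t = p t := fun t ht => if_pos ht
  have hyz : ∀ t, T ≤ t → y t = z t := fun t ht => if_neg (not_lt.2 ht)
  refine ⟨δ, hδ, y, fun t ht => ?_, fun t ht => hyp t ht.2⟩
  rcases lt_trichotomy t T with h | rfl | h
  · rw [hyp t h]
    refine (hp t ⟨ht.1, h⟩).congr_of_eventuallyEq ?_ (hyp t h)
    exact eventually_nhdsWithin_of_eventually_nhds ((gt_mem_nhds h).mono fun s hs => hyp s hs)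
  · rw [hyz t le_rfl, hzT]
    have hright : HasDerivWithinAt y (F t q) (Ici t) t := by
      have := (hz t ⟨le_rfl, by linarith⟩).1
      rw [hzT] at this
      exact this.congr (fun s hs => hyz s hs) (hyz t le_rfl)
    have hmem : Ioo 0 t ∈ 𝓝[<] t := Ioo_mem_nhdsLT hT
    have hlt : Tendsto p (𝓝[<] t) (𝓝 q) := by
      refine hlim.mono_left ?_
      rw [← nhdsWithin_Ioo_eq_nhdsLT hT]
      exact nhdsWithin_mono _ Ioo_subset_Ico_self
    have hder : ∀ s ∈ Ioo 0 t, HasDerivAt y (F s (p s)) s := fun s hs => by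
      have h1 := (hp s ⟨hs.1.le, hs.2⟩).hasDerivAt (Ici_mem_nhds hs.1)
      exact h1.congr_of_eventuallyEq ((gt_mem_nhds hs.2).mono fun r hr => hyp r hr)
    -- At the gluing time the left derivative is the limit of the derivatives `F s (p s)`, which is
    -- `F t q` by continuity of the field; it matches the right derivative from the local solution.
    have hleft : HasDerivWithinAt y (F t q) (Iic t) t := by
      refine hasDerivWithinAt_Iic_of_tendsto_deriv (s := Ioo 0 t)
        (fun s hs => (hder s hs).differentiableAt.differentiableWithinAt) ?_ hmem ?_
      · rw [ContinuousWithinAt, hyz t le_rfl, hzT, nhdsWithin_Ioo_eq_nhdsLT hT]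
        exact hlt.congr' (eventually_nhdsWithin_of_forall fun s hs => (hyp s hs).symm)
      · have h1 : Tendsto (fun s => (s, p s)) (𝓝[<] t) (𝓝 (t, q)) :=
          (tendsto_id.mono_left nhdsWithin_le_nhds).prodMk_nhds hlt
        have h2 := ((hF.continuousAt (hU.mem_nhds hq)).tendsto.comp h1)
        refine h2.congr' ?_
        filter_upwards [hmem] with s hs
        exact (hder s hs).deriv.symm
    have := hleft.union hright
    rw [Iic_union_Ici] at this
    exact this.mono (subset_univ _)
  · rw [hyz t h.le]
    have h1 := ((hz t ⟨h.le, ht.2⟩).1.hasDerivAt (Ici_mem_nhds h))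
    exact (h1.congr_of_eventuallyEq
      ((lt_mem_nhds h).mono fun s hs => hyz s hs.le)).hasDerivWithinAt

/-- If solutions inside the open set `U` cannot leave it in finite time, then solutions starting in `U`
stay there. -/
lemma SolvesOn.mem_of_trapped {F : ℝ → E → E} {U : Set (ℝ × E)} (hU : IsOpen U) {p₀ : E}
    (h₀ : ((0 : ℝ), p₀) ∈ U)
    (trap : ∀ T > 0, ∀ p : ℝ → E, p 0 = p₀ → SolvesOn F (Ico 0 T) p →
      (∀ t ∈ Ico 0 T, (t, p t) ∈ U) → ∀ q, Tendsto p (𝓝[Ico 0 T] T) (𝓝 q) → (T, q) ∈ U)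
    {T : ℝ} {p : ℝ → E} (hp₀ : p 0 = p₀) (hp : SolvesOn F (Ico 0 T) p) :
    ∀ t ∈ Ico 0 T, (t, p t) ∈ U := by
  by_contra! hcon
  obtain ⟨t, ht, htU⟩ := hcon
  -- Let `τ` be the infimum of the times outside `U`. The point at `τ` is in `U`, by `h₀` if `τ = 0`
  -- and by `trap` otherwise; openness then keeps the solution in `U` a little beyond `τ`, a
  -- contradiction.
  let S := {s | s ∈ Ico 0 T ∧ (s, p s) ∉ U}
  have hSb : BddBelow S := ⟨0, fun s hs => hs.1.1⟩
  have hSne : S.Nonempty := ⟨t, ht, htU⟩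
  have h0 : 0 ≤ sInf S := le_csInf hSne fun s hs => hs.1.1
  have hlt : sInf S < T := (csInf_le hSb ⟨ht, htU⟩).trans_lt ht.2
  have hbelow : ∀ s ∈ Ico 0 (sInf S), (s, p s) ∈ U := fun s hs => by
    by_contra h
    exact absurd (csInf_le hSb ⟨⟨hs.1, hs.2.trans hlt⟩, h⟩) (not_le.2 hs.2)
  set τ := sInf S with hτ
  have hcont : ContinuousWithinAt (fun s => (s, p s)) (Ici 0) τ :=
    continuousWithinAt_id.prodMk (hp τ ⟨h0, hlt⟩).continuousWithinAt
  have hτU : (τ, p τ) ∈ U := by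
    rcases h0.eq_or_lt with h | h
    · rw [← h, hp₀]; exact h₀
    · exact trap τ h p hp₀ (hp.mono (Ico_subset_Ico_right hlt.le)) hbelow _
        ((hp τ ⟨h0, hlt⟩).continuousWithinAt.mono Ico_subset_Ici_self)
  have hev : ∀ᶠ s in 𝓝[≥] τ, (s, p s) ∈ U :=
    (hcont.mono (Ici_subset_Ici.2 h0)).eventually_mem (hU.mem_nhds hτU)
  obtain ⟨u, hu, hu'⟩ := mem_nhdsGE_iff_exists_Ico_subset.1 hev
  obtain ⟨s, hs, hsu⟩ := exists_lt_of_csInf_lt hSne (show sInf S < u from hu)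
  exact hs.2 (hu' ⟨csInf_le hSb hs, hsu⟩)

/-- If solutions on bounded intervals can always be continued, then they can be continued globally. -/
lemma SolvesOn.exists_global {F : ℝ → E → E} {T : ℝ} (hT : 0 < T) {x : ℝ → E}
    (hx : SolvesOn F (Ico 0 T) x)
    (step : ∀ T' ≥ T, ∀ p : ℝ → E, EqOn p x (Ico 0 T) → SolvesOn F (Ico 0 T') p →
      ∃ δ > 0, ∃ y : ℝ → E, SolvesOn F (Ico 0 (T' + δ)) y ∧ EqOn y p (Ico 0 T')) :
    ∃ y : ℝ → E, SolvesOn F (Ici 0) y ∧ EqOn y x (Ico 0 T) := by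
  classical
  -- Zorn's lemma on pairs of a domain and a solution, ordered by extension. The third clause makes
  -- domains initial segments without last point, so near each of its times the union of a chain
  -- coincides with a single member and inherits its derivative. It also forces a bounded maximal
  -- domain to be `[0, T')`, to which `step` applies.
  let good : Set ℝ × (ℝ → E) → Prop := fun a => a.1 ⊆ Ici 0 ∧ Ico 0 T ⊆ a.1 ∧
    (∀ t ∈ a.1, ∃ u > t, Ico 0 u ⊆ a.1) ∧ SolvesOn F a.1 a.2 ∧ EqOn a.2 x (Ico 0 T)
  let r : {a // good a} → {a // good a} → Prop := fun a b => a.1.1 ⊆ b.1.1 ∧ EqOn b.1.2 a.1.2 a.1.1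
  have base : good (Ico 0 T, x) :=
    ⟨Ico_subset_Ici_self, Subset.rfl, fun t ht => ⟨T, ht.2, Subset.rfl⟩, hx, fun _ _ => rfl⟩
  have chain : ∀ c, IsChain r c → ∃ ub, ∀ a ∈ c, r a ub := by
    intro c hc
    rcases c.eq_empty_or_nonempty with rfl | ⟨a₀, ha₀⟩
    · exact ⟨⟨_, base⟩, by simp⟩
    let I : Set ℝ := ⋃ a ∈ c, (a : {a // good a}).1.1
    let p : ℝ → E := fun t => if h : ∃ a ∈ c, t ∈ (a : {a // good a}).1.1 then h.choose.1.2 t else 0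
    have hpa : ∀ a ∈ c, EqOn p a.1.2 a.1.1 := fun a ha t ht => by
      have h : ∃ a ∈ c, t ∈ (a : {a // good a}).1.1 := ⟨a, ha, ht⟩
      simp only [p, dif_pos h]
      rcases eq_or_ne h.choose a with e | hne
      · rw [e]
      rcases hc h.choose_spec.1 ha hne with h1 | h1
      · exact (h1.2 h.choose_spec.2).symm
      · exact h1.2 ht
    have hsub : ∀ a ∈ c, a.1.1 ⊆ I := fun a ha => subset_biUnion_of_mem (u := fun a : {a // good a} => a.1.1) ha
    have hgood : good (I, p) := by
      refine ⟨iUnion₂_subset fun a _ => a.2.1, a₀.2.2.1.trans (hsub a₀ ha₀), fun t ht => ?_,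
        fun t ht => ?_, fun t ht => ?_⟩
      · obtain ⟨a, ha, hta⟩ := mem_iUnion₂.1 ht
        obtain ⟨u, hu, hu'⟩ := a.2.2.2.1 t hta
        exact ⟨u, hu, hu'.trans (hsub a ha)⟩
      · obtain ⟨a, ha, hta⟩ := mem_iUnion₂.1 ht
        obtain ⟨u, hu, hu'⟩ := a.2.2.2.1 t hta
        change HasDerivWithinAt p (F t (p t)) (Ici 0) t
        rw [hpa a ha hta]
        refine (a.2.2.2.2.1 t hta).congr_of_eventuallyEq ?_ (hpa a ha hta)
        filter_upwards [self_mem_nhdsWithin, mem_nhdsWithin_of_mem_nhds (gt_mem_nhds hu)] with s h1 h2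
        exact hpa a ha (hu' ⟨h1, h2⟩)
      · exact (hpa a₀ ha₀ (a₀.2.2.1 ht)).trans (a₀.2.2.2.2.2 ht)
    exact ⟨⟨_, hgood⟩, fun a ha => ⟨hsub a ha, hpa a ha⟩⟩
  obtain ⟨⟨⟨I, p⟩, hI0, hIT, hIo, hp, hpx⟩, hmax⟩ := exists_maximal_of_chains_bounded (r := r)
    chain (fun {a b d} hab hbd => ⟨hab.1.trans hbd.1, fun t ht =>
      (hbd.2 (hab.1 ht)).trans (hab.2 ht)⟩)
  suffices h : I = Ici 0 by exact ⟨p, h ▸ hp, hpx⟩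
  have hmem : ∀ s ∈ I, ∀ t, 0 ≤ t → t ≤ s → t ∈ I := fun s hs t h0 hts => by
    obtain ⟨u, hu, hu'⟩ := hIo s hs
    exact hu' ⟨h0, hts.trans_lt hu⟩
  refine hI0.antisymm fun t ht => ?_
  by_contra htI
  have hbdd : ∀ s ∈ I, s ≤ t := fun s hs => by
    by_contra h
    exact htI (hmem s hs t ht (not_le.1 h).le)
  have hB : BddAbove I := ⟨t, hbdd⟩
  have hne : I.Nonempty := ⟨0, hIT ⟨le_rfl, hT⟩⟩
  have hIeq : I = Ico 0 (sSup I) := by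
    ext s
    refine ⟨fun hs => ⟨hI0 hs, ?_⟩, fun hs => ?_⟩
    · obtain ⟨u, hu, hu'⟩ := hIo s hs
      have : (s + u) / 2 ∈ I := hu' ⟨by have := hI0 hs; simp at this; linarith, by linarith⟩
      exact lt_of_lt_of_le (by linarith) (le_csSup hB this)
    · obtain ⟨u, hu, hsu⟩ := exists_lt_of_lt_csSup hne hs.2
      exact hmem u hu s hs.1 hsu.le
  set T' := sSup I
  have hTT' : T ≤ T' := by
    by_contra h
    have h0 : 0 ≤ T' := le_csSup hB (hIT ⟨le_rfl, hT⟩)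
    have : T' ∈ I := hIT ⟨h0, not_le.1 h⟩
    rw [hIeq] at this
    exact lt_irrefl _ this.2
  obtain ⟨δ, hδ, y, hy, hyp⟩ := step T' hTT' p hpx (hIeq ▸ hp)
  have hgood : good (Ico 0 (T' + δ), y) := by
    refine ⟨Ico_subset_Ici_self, Ico_subset_Ico_right (by linarith), fun t ht => ⟨_, ht.2, Subset.rfl⟩,
      hy, fun t ht => ?_⟩
    exact (hyp ⟨ht.1, ht.2.trans_le hTT'⟩).trans (hpx ht)
  have := hmax ⟨_, hgood⟩ ⟨by
    change I ⊆ Ico 0 (T' + δ); rw [hIeq]; exact Ico_subset_Ico_right (by linarith), by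
    change EqOn y p I; rw [hIeq]; exact hyp⟩
  have h1 : Ico 0 (T' + δ) ⊆ Ico 0 T' := by rw [← hIeq]; exact this.1
  exact lt_irrefl _ (h1 ⟨by linarith, by linarith⟩ : T' ∈ Ico 0 T').2

end ODE

section ODEGlobal

open Filter Topology

variable {E : Type*} [NormedAddCommGroup E] [NormedSpace ℝ E]

/-- Global continuation of solutions that are trapped in the open domain of the vector field and have
bounded velocity on bounded time intervals. -/
theorem SolvesOn.exists_global_of_trapped [FiniteDimensional ℝ E] {F : ℝ → E → E}
    {U : Set (ℝ × E)} (hU : IsOpen U) (hF : ContinuousOn (fun z : ℝ × E => F z.1 z.2) U) {p₀ : E}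
    (h₀ : ((0 : ℝ), p₀) ∈ U)
    (trap : ∀ T > 0, ∀ p : ℝ → E, p 0 = p₀ → SolvesOn F (Ico 0 T) p →
      (∀ t ∈ Ico 0 T, (t, p t) ∈ U) → (∃ B, ∀ t ∈ Ico 0 T, ‖F t (p t)‖ ≤ B) ∧
        ∀ q, Tendsto p (𝓝[Ico 0 T] T) (𝓝 q) → (T, q) ∈ U)
    {T : ℝ} (hT : 0 < T) {x : ℝ → E} (hx₀ : x 0 = p₀) (hx : SolvesOn F (Ico 0 T) x) :
    ∃ y : ℝ → E, SolvesOn F (Ici 0) y ∧ EqOn y x (Ico 0 T) := by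
  refine hx.exists_global hT fun T' hT' p hpx hp => ?_
  have hp₀ : p 0 = p₀ := (hpx ⟨le_rfl, hT⟩).trans hx₀
  have hT'0 : 0 < T' := hT.trans_le hT'
  have hmem := hp.mem_of_trapped hU h₀ (fun T hT p h1 h2 h3 => (trap T hT p h1 h2 h3).2) hp₀
  obtain ⟨⟨B, hB⟩, hlim⟩ := trap T' hT'0 p hp₀ hp hmem
  obtain ⟨q, hq⟩ := hp.exists_tendsto hB
  exact hp.exists_extension hU hF hT'0 hq (hlim q hq)

theorem exists_solution_of_trapped [FiniteDimensional ℝ E] {F : ℝ → E → E}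
    {U : Set (ℝ × E)} (hU : IsOpen U) (hF : ContinuousOn (fun z : ℝ × E => F z.1 z.2) U) {p₀ : E}
    (h₀ : ((0 : ℝ), p₀) ∈ U)
    (trap : ∀ T > 0, ∀ p : ℝ → E, p 0 = p₀ → SolvesOn F (Ico 0 T) p →
      (∀ t ∈ Ico 0 T, (t, p t) ∈ U) → (∃ B, ∀ t ∈ Ico 0 T, ‖F t (p t)‖ ≤ B) ∧
        ∀ q, Tendsto p (𝓝[Ico 0 T] T) (𝓝 q) → (T, q) ∈ U) :
    ∃ y : ℝ → E, SolvesOn F (Ici 0) y ∧ y 0 = p₀ := by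
  obtain ⟨δ, hδ, p, hp0, hp⟩ := exists_local_solution hU hF h₀
  obtain ⟨y, hy, hyp⟩ := SolvesOn.exists_global_of_trapped hU hF h₀ trap hδ hp0
    (fun t ht => (hp t (by simpa using ht)).1)
  exact ⟨y, hy, (hyp ⟨le_rfl, hδ⟩).trans hp0⟩

end ODEGlobal

/-! ### Barrier potentials and uniform positive definiteness -/

section Barrier

/-- The derivative of `∑ ε²` is at most `2 * C`, so `∑ ε² - 2 * C * t` decreases; on a bounded
interval this bounds `∑ ε²`, and `|ε| ≤ ε² + 1`. -/
lemma exists_bound_of_sum_mul_deriv_le {ι : Type*} (s : Finset ι) {ε d : ι → ℝ → ℝ} {T C : ℝ}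
    (hε : ∀ j ∈ s, ∀ t ∈ Ico 0 T, HasDerivWithinAt (ε j) (d j t) (Ici 0) t)
    (hC : ∀ t ∈ Ico 0 T, ∑ j ∈ s, ε j t * d j t ≤ C) :
    ∃ K, ∀ t ∈ Ico 0 T, ∀ j ∈ s, |ε j t| ≤ K := by
  have hder : ∀ t ∈ Ico 0 T, HasDerivWithinAt (fun t => ∑ j ∈ s, ε j t ^ 2 - 2 * C * t)
      (2 * ∑ j ∈ s, ε j t * d j t - 2 * C) (Ici 0) t := fun t ht => by
    have h1 := HasDerivWithinAt.fun_sum fun j hj => (hε j hj t ht).fun_pow 2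
    have h2 := h1.sub ((hasDerivWithinAt_id t (Ici 0)).const_mul (2 * C))
    refine h2.congr_deriv ?_
    rw [Finset.mul_sum]
    congr 1
    · exact Finset.sum_congr rfl fun j _ => by ring
    · ring
  have hanti : AntitoneOn (fun t => ∑ j ∈ s, ε j t ^ 2 - 2 * C * t) (Ico 0 T) := by
    refine antitoneOn_of_hasDerivWithinAt_nonpos (convex_Ico 0 T)
      (fun t ht => (hder t ht).continuousWithinAt.mono Ico_subset_Ici_self)
      (fun t ht => (hder t (interior_subset ht)).mono (interior_subset.trans Ico_subset_Ici_self))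
      fun t ht => ?_
    linarith [hC t (interior_subset ht)]
  refine ⟨∑ j ∈ s, ε j 0 ^ 2 + 2 * |C| * T + 1, fun t ht j hj => ?_⟩
  have h0 := hanti ⟨le_rfl, ht.1.trans_lt ht.2⟩ ht ht.1
  simp only [mul_zero, sub_zero] at h0
  have h1 : ε j t ^ 2 ≤ ∑ j ∈ s, ε j t ^ 2 :=
    Finset.single_le_sum (f := fun j => ε j t ^ 2) (fun j _ => sq_nonneg _) hj
  have h2 : C * t ≤ |C| * T :=
    mul_le_mul (le_abs_self C) ht.2.le ht.1 (abs_nonneg C)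
  have h3 : |ε j t| ≤ ε j t ^ 2 + 1 := by
    rw [← sq_abs]; nlinarith [sq_nonneg (|ε j t| - 1)]
  linarith

/-- Prescribed performance: the transformed errors `τ (y_j / r_j)` stay bounded on bounded time intervals
if the derivatives of the errors `y_j` dissipate the barrier potential `½ ∑ τ²`. -/
lemma exists_bound_transformed_error {ι : Type*} (s : Finset ι) {T : ℝ} {τ J : ℝ → ℝ} {S : Set ℝ}
    (hS : ∀ e ∈ S, |e| ≤ 1) (hτ : ∀ e ∈ S, HasDerivAt τ (J e) e) {r y r' y' : ι → ℝ → ℝ}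
    (hr0 : ∀ j ∈ s, ∀ t ∈ Ico 0 T, 0 < r j t)
    (hr : ∀ j ∈ s, ∀ t ∈ Ico 0 T, HasDerivWithinAt (r j) (r' j t) (Ici 0) t)
    (hy : ∀ j ∈ s, ∀ t ∈ Ico 0 T, HasDerivWithinAt (y j) (y' j t) (Ici 0) t)
    (hmem : ∀ j ∈ s, ∀ t ∈ Ico 0 T, (r j t)⁻¹ * y j t ∈ S) {c B : ℝ} (hc : 0 < c)
    (hB : ∀ j ∈ s, ∀ t ∈ Ico 0 T, |r' j t| ≤ B)
    (hmain : ∀ t ∈ Ico 0 T,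
      ∑ j ∈ s, (r j t)⁻¹ * J ((r j t)⁻¹ * y j t) * τ ((r j t)⁻¹ * y j t) * y' j t ≤
        -c * ∑ j ∈ s, ((r j t)⁻¹ * J ((r j t)⁻¹ * y j t) * τ ((r j t)⁻¹ * y j t)) ^ 2 +
        B * ∑ j ∈ s, |(r j t)⁻¹ * J ((r j t)⁻¹ * y j t) * τ ((r j t)⁻¹ * y j t)|) :
    ∃ K, ∀ t ∈ Ico 0 T, ∀ j ∈ s, |τ ((r j t)⁻¹ * y j t)| ≤ K := by
  -- `z j` is the derivative of `½ ∑ τ²` with respect to `y j`.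
  set z : ι → ℝ → ℝ := fun j t => (r j t)⁻¹ * J ((r j t)⁻¹ * y j t) * τ ((r j t)⁻¹ * y j t) with hz
  refine exists_bound_of_sum_mul_deriv_le s (ε := fun j t => τ ((r j t)⁻¹ * y j t))
    (d := fun j t => J ((r j t)⁻¹ * y j t) * ((r j t)⁻¹ * (y' j t - r' j t * ((r j t)⁻¹ * y j t))))
    (C := ∑ j ∈ s, B ^ 2 / c) (fun j hj t ht => ?_) fun t ht => ?_
  · have h0 := (hr0 j hj t ht).ne'
    have h1 := ((hr j hj t ht).fun_inv h0).fun_mul (hy j hj t ht)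
    refine (hτ _ (hmem j hj t ht)).comp_hasDerivWithinAt t (h1.congr_deriv ?_)
    field_simp
    ring
  · have h1 : ∀ j ∈ s, τ ((r j t)⁻¹ * y j t) * (J ((r j t)⁻¹ * y j t) *
        ((r j t)⁻¹ * (y' j t - r' j t * ((r j t)⁻¹ * y j t)))) ≤ z j t * y' j t + B * |z j t| :=
      fun j hj => by
        have e1 : |z j t * (r' j t * ((r j t)⁻¹ * y j t))| ≤ |z j t| * (B * 1) := by
          rw [abs_mul (z j t), abs_mul (r' j t)]
          have := hS _ (hmem j hj t ht)
          have := hB j hj t ht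
          exact mul_le_mul_of_nonneg_left (mul_le_mul ‹_› ‹_› (abs_nonneg _)
            ((abs_nonneg _).trans ‹|r' j t| ≤ B›)) (abs_nonneg _)
        have e2 := neg_abs_le (z j t * (r' j t * ((r j t)⁻¹ * y j t)))
        calc _ = z j t * y' j t - z j t * (r' j t * ((r j t)⁻¹ * y j t)) := by
              simp only [hz]; ring
          _ ≤ _ := by linarith
    refine (Finset.sum_le_sum h1).trans ?_
    rw [Finset.sum_add_distrib, ← Finset.mul_sum]
    have h2 := hmain t ht
    -- One `B * |z|` comes from `hmain`, the other from the motion of the funnel, where `|r'| ≤ B`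
    -- and the normalized error is at most `1`. Completing the square gives `B ^ 2 / c`.
    have h3 : ∀ j ∈ s, -c * z j t ^ 2 + 2 * B * |z j t| ≤ B ^ 2 / c := fun j _ => by
      rw [le_div_iff₀ hc, ← sq_abs]
      nlinarith [sq_nonneg (c * |z j t| - B)]
    have h4 := Finset.sum_le_sum h3
    rw [Finset.sum_add_distrib, ← Finset.mul_sum, ← Finset.mul_sum] at h4
    linarith

/-- A continuous family of positive definite quadratic forms over a compact set is uniformly positive
definite. -/
lemma exists_quadratic_lower_bound {α ι : Type*} [TopologicalSpace α] [Fintype ι] {K : Set α}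
    (hK : IsCompact K) {Q : α → (ι → ℝ) → ℝ}
    (hQ : ContinuousOn (fun p : α × (ι → ℝ) => Q p.1 p.2) (K ×ˢ univ))
    (hom : ∀ y c z, Q y (c • z) = c ^ 2 * Q y z) (hpos : ∀ y ∈ K, ∀ z ≠ 0, 0 < Q y z) :
    ∃ c > 0, ∀ y ∈ K, ∀ z, c * ∑ j, z j ^ 2 ≤ Q y z := by
  let S : Set (ι → ℝ) := {z | ∑ j, z j ^ 2 = 1}
  have hS : IsCompact S := by
    refine (isCompact_closedBall (0 : ι → ℝ) 1).of_isClosed_subset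
      (isClosed_eq (by fun_prop) continuous_const) fun z hz => ?_
    rw [mem_closedBall_zero_iff, pi_norm_le_iff_of_nonneg zero_le_one]
    intro j
    rw [Real.norm_eq_abs, ← sq_le_one_iff_abs_le_one]
    exact (Finset.single_le_sum (f := fun j => z j ^ 2) (fun j _ => sq_nonneg _)
      (Finset.mem_univ j)).trans hz.le
  have hne : ∀ z ∈ S, z ≠ 0 := by
    intro z hz hz0
    rw [hz0] at hz
    have : ∑ j, (0 : ι → ℝ) j ^ 2 = 1 := hz
    rw [Finset.sum_eq_zero fun j _ => by rw [Pi.zero_apply]; ring] at this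
    exact zero_ne_one this
  -- A positive lower bound on the Euclidean unit sphere, uniform over `K` by compactness, extends
  -- to all vectors by homogeneity of degree two.
  obtain ⟨c, hc, hcQ⟩ := (hK.prod hS).exists_forall_le' (a := 0)
    (hQ.mono (prod_mono Subset.rfl (subset_univ _)))
    (fun p hp => hpos p.1 hp.1 p.2 (hne _ hp.2))
  refine ⟨c, hc, fun y hy z => ?_⟩
  by_cases hz : z = 0
  · have h0 := hom y 0 z
    rw [zero_smul, zero_pow two_ne_zero, zero_mul] at h0
    rw [hz, h0, Finset.sum_eq_zero fun j _ => by rw [Pi.zero_apply]; ring, mul_zero]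
  have hpos' : 0 < ∑ j, z j ^ 2 := by
    obtain ⟨j, hj⟩ := Function.ne_iff.1 hz
    exact Finset.sum_pos' (fun j _ => sq_nonneg _) ⟨j, Finset.mem_univ j, sq_pos_of_ne_zero hj⟩
  set q := √(∑ j, z j ^ 2)
  have hq : q ^ 2 = ∑ j, z j ^ 2 := Real.sq_sqrt hpos'.le
  have hq0 : 0 < q := Real.sqrt_pos.2 hpos'
  have h1 := hcQ (y, q⁻¹ • z) ⟨hy, by
    change ∑ j, (q⁻¹ • z) j ^ 2 = 1
    simp only [Pi.smul_apply, smul_eq_mul, mul_pow, ← Finset.mul_sum, ← hq]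
    field_simp⟩
  simp only [hom] at h1
  rw [← hq]
  calc c * q ^ 2 ≤ (q⁻¹ ^ 2 * Q y z) * q ^ 2 := by gcongr
    _ = Q y z := by field_simp

end Barrier

/-! ### The logarithmic error transformations -/

section Transforms

lemma hasDerivAt_obsTrans {e : ℝ} (he : e ∈ Ioo (-1 : ℝ) 1) : HasDerivAt obsTrans (obsJac e) e := by
  have h1 : (1 + e) ≠ 0 := by linarith [he.1]
  have h2 : (1 - e) ≠ 0 := by linarith [he.2]
  have := ((((hasDerivAt_id e).const_add 1).div ((hasDerivAt_id e).const_sub 1) h2)).log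
    (div_ne_zero h1 h2)
  refine this.congr_deriv ?_
  have h3 : 1 - e ^ 2 ≠ 0 := by
    rw [show 1 - e ^ 2 = (1 + e) * (1 - e) by ring]; exact mul_ne_zero h1 h2
  simp only [obsJac, id]
  simp only [Pi.div_apply]
  field_simp
  ring

lemma hasDerivAt_taskTrans {e : ℝ} (he : e ∈ Ioo (-1 : ℝ) 0) :
    HasDerivAt taskTrans (taskJac e) e := by
  have h1 : (e + 1) ≠ 0 := by linarith [he.1]
  have h2 : e ≠ 0 := he.2.ne
  have := ((((hasDerivAt_id e).add_const 1).neg.div (hasDerivAt_id e) h2)).log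
    (div_ne_zero (neg_ne_zero.2 h1) h2)
  refine this.congr_deriv ?_
  simp only [taskJac, id, Pi.div_apply, Pi.neg_apply]
  field_simp
  ring

/-- The transformation is increasing and blows up at both ends of the funnel, so a bound on it keeps
the error away from the boundary. The endpoints are the preimages of `-K` and `K`. -/
lemma exists_Icc_of_abs_obsTrans_le (K : ℝ) : ∃ a b : ℝ, -1 < a ∧ b < 1 ∧
    ∀ e ∈ Ioo (-1 : ℝ) 1, |obsTrans e| ≤ K → e ∈ Icc a b := by
  have hE := Real.exp_pos K
  refine ⟨(1 - Real.exp K) / (1 + Real.exp K), (Real.exp K - 1) / (1 + Real.exp K), ?_, ?_,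
    fun e he h => ?_⟩
  · rw [lt_div_iff₀ (by positivity)]; linarith
  · rw [div_lt_iff₀ (by positivity)]; linarith
  have h1 : 0 < 1 + e := by linarith [he.1]
  have h2 : 0 < 1 - e := by linarith [he.2]
  obtain ⟨h3, h4⟩ := abs_le.1 h
  rw [obsTrans] at h3 h4
  have h5 := (Real.log_le_iff_le_exp (by positivity)).1 h4
  have h6 := (Real.le_log_iff_exp_le (by positivity)).1 h3
  rw [div_le_iff₀ h2] at h5
  rw [Real.exp_neg, inv_le_iff_one_le_mul₀ hE, div_mul_eq_mul_div, le_div_iff₀ h2] at h6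
  constructor
  · rw [div_le_iff₀ (by positivity)]; linarith
  · rw [le_div_iff₀ (by positivity)]; linarith

/-- As for `obsTrans`, the endpoints being the preimages of `-K` and `K` under `taskTrans`. -/
lemma exists_Icc_of_abs_taskTrans_le (K : ℝ) : ∃ a b : ℝ, -1 < a ∧ b < 0 ∧
    ∀ e ∈ Ioo (-1 : ℝ) 0, |taskTrans e| ≤ K → e ∈ Icc a b := by
  have hE := Real.exp_pos K
  refine ⟨-(Real.exp K / (1 + Real.exp K)), -(1 / (1 + Real.exp K)), ?_, ?_,
    fun e he h => ?_⟩
  · rw [neg_lt_neg_iff, div_lt_iff₀ (by positivity)]; linarith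
  · rw [neg_lt_zero]; positivity
  have h1 : 0 < e + 1 := by linarith [he.1]
  have h2 : 0 < -e := by linarith [he.2]
  obtain ⟨h3, h4⟩ := abs_le.1 h
  rw [taskTrans, neg_div, ← div_neg] at h3 h4
  have h5 := (Real.log_le_iff_le_exp (by positivity)).1 h4
  have h6 := (Real.le_log_iff_exp_le (by positivity)).1 h3
  rw [div_le_iff₀ h2] at h5
  rw [Real.exp_neg, inv_le_iff_one_le_mul₀ hE, div_mul_eq_mul_div, le_div_iff₀ h2] at h6
  constructor
  · rw [neg_le, div_eq_mul_inv, ← div_eq_mul_inv, le_div_iff₀ (by positivity)]; linarith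
  · rw [le_neg, div_le_iff₀ (by positivity)]; linarith

end Transforms

/-! ### The observer matrix and estimation errors -/

section Observer

open Matrix

variable {V : Type*}

/-- `l` is the vertex next to `j` on a shortest path to `i`. -/
lemma exists_adj_dist_eq {G : SimpleGraph V} (hG : G.Connected) {i j : V} {d : ℕ}
    (h : G.dist i j = d + 1) : ∃ l, G.Adj j l ∧ G.dist i l = d := by
  obtain ⟨p, hp⟩ := hG.exists_walk_length_eq_dist j i
  rw [SimpleGraph.dist_comm, h] at hp
  cases p with
  | nil => simp at hp
  | @cons _ l _ hadj q =>
    refine ⟨l, hadj, ?_⟩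
    have h1 : G.dist i l ≤ d := by
      rw [SimpleGraph.dist_comm]
      refine (SimpleGraph.dist_le q).trans ?_
      simpa using hp.le
    have h2 := hG.dist_triangle (u := i) (v := l) (w := j)
    rw [SimpleGraph.dist_eq_one_iff_adj.2 hadj.symm] at h2
    omega

variable [Fintype V] [DecidableEq V]

lemma obsMatrix_mulVec_apply (G : SimpleGraph V) (k : ℕ) (i : V) (v : kHop G k i → ℝ)
    (f : V → ℝ) (hf : ∀ j : kHop G k i, f j = v j) (j : kHop G k i)
    [DecidablePred fun l => G.Adj j l ∧ l ∈ kHop G k i] :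
    (obsMatrix G k i *ᵥ v) j = (∑ l with G.Adj j l ∧ l ∈ kHop G k i, (f j - f l)) +
      ((G.neighborSet j ∩ G.neighborSet i).ncard : ℝ) * v j := by
  classical
  have h1 : ∑ l with G.Adj j l ∧ l ∈ kHop G k i, (f j - f l) =
      ∑ u ∈ (G.induce (kHop G k i)).neighborFinset j, (v j - v u) := by
    symm
    refine Finset.sum_bij (fun u _ => u.1) (fun u hu => ?_) (fun u _ w _ h => Subtype.ext h)
      (fun l hl => ?_) (fun u _ => ?_)
    · simpa using hu
    · rw [Finset.mem_filter] at hl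
      exact ⟨⟨l, hl.2.2⟩, by simpa using hl.2.1, rfl⟩
    · rw [hf, hf]
  rw [h1, obsMatrix, add_mulVec, Pi.add_apply, mulVec_diagonal]
  congr 1
  rw [Finset.sum_sub_distrib, Finset.sum_const, SimpleGraph.card_neighborFinset_eq_degree, nsmul_eq_mul]
  convert SimpleGraph.lapMatrix_mulVec_apply (R := ℝ) (G := G.induce (kHop G k i)) j v

/-- The true state cancels in differences of two estimates, so the disagreements are `M_i` applied
to the vector of estimation errors. -/
lemma disagreement_eq_mulVec {n : V → ℕ} (G : SimpleGraph V) (k : ℕ) (x : State n)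
    (xhat : Estimates n) (i : V) (j : kHop G k i) (a : Fin (n i)) :
    disagreement G k x xhat i j a =
      (obsMatrix G k i *ᵥ fun r : kHop G k i => xhat r i a - x i a) j := by
  classical
  rw [obsMatrix_mulVec_apply G k i _ (fun r => xhat r i a - x i a) (fun _ => rfl), disagreement]
  congr 1
  refine Finset.sum_congr (by congr) fun l _ => by ring

/-- The form is a sum of squared differences over edges plus weighted squares `z_j²`. If it
vanishes, `z` is constant along edges between `k`-hop neighbors, and zero at distance 2 from `i`,
where a neighbor shared with `i` makes the weight positive. A shortest path towards `i` stays among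
`k`-hop neighbors until distance 2, so `z` is zero everywhere. -/
lemma obsMatrix_quadratic_pos {G : SimpleGraph V} (hG : G.Connected) (k : ℕ) (i : V)
    {z : kHop G k i → ℝ} (hz : z ≠ 0) : 0 < z ⬝ᵥ (obsMatrix G k i *ᵥ z) := by
  classical
  have h1 : z ⬝ᵥ (obsMatrix G k i *ᵥ z) =
      (∑ a, ∑ b, if (G.induce (kHop G k i)).Adj a b then (z a - z b) ^ 2 else 0) / 2 +
        ∑ j : kHop G k i, ((G.neighborSet j ∩ G.neighborSet i).ncard : ℝ) * z j ^ 2 := by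
    rw [obsMatrix, add_mulVec, dotProduct_add]
    congr 1
    · have := SimpleGraph.lapMatrix_toLinearMap₂' (R := ℝ) (G := G.induce (kHop G k i)) z
      rw [Matrix.toLinearMap₂'_apply'] at this
      convert this
    · simp only [dotProduct, mulVec_diagonal]
      exact Finset.sum_congr rfl fun j _ => by ring
  have hA : ∀ a b, 0 ≤ (if (G.induce (kHop G k i)).Adj a b then (z a - z b) ^ 2 else 0) :=
    fun a b => by split_ifs <;> positivity
  have hA0 : ∀ a, 0 ≤ ∑ b, (if (G.induce (kHop G k i)).Adj a b then (z a - z b) ^ 2 else 0) :=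
    fun a => Finset.sum_nonneg fun b _ => hA a b
  have hB : ∀ j : kHop G k i, 0 ≤ ((G.neighborSet j ∩ G.neighborSet i).ncard : ℝ) * z j ^ 2 :=
    fun j => by positivity
  have s1 := Finset.sum_nonneg fun a (_ : a ∈ Finset.univ) => hA0 a
  have s2 := Finset.sum_nonneg fun j (_ : j ∈ Finset.univ) => hB j
  rw [h1]
  by_contra! hle
  refine hz ?_
  have e1 := (Finset.sum_eq_zero_iff_of_nonneg fun a _ => hA0 a).1
    (le_antisymm (by linarith) s1)
  have e2 := (Finset.sum_eq_zero_iff_of_nonneg fun j _ => hB j).1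
    (le_antisymm (by linarith) s2)
  have hadj : ∀ a b : kHop G k i, G.Adj a b → z a = z b := fun a b hab => by
    have := (Finset.sum_eq_zero_iff_of_nonneg fun b _ => hA a b).1 (e1 a (Finset.mem_univ a)) b
      (Finset.mem_univ b)
    rw [if_pos (by simpa using hab)] at this
    exact sub_eq_zero.1 (pow_eq_zero_iff two_ne_zero |>.1 this)
  have hall : ∀ d, ∀ j : kHop G k i, G.dist i j = d + 2 → z j = 0 := by
    intro d
    induction d with
    | zero =>
      intro j hj
      obtain ⟨l, hjl, hl⟩ := exists_adj_dist_eq hG (d := 1) hj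
      have hne : (G.neighborSet j ∩ G.neighborSet i).ncard ≠ 0 := by
        have hmem : (G.neighborSet j ∩ G.neighborSet i).Nonempty :=
          ⟨l, hjl, SimpleGraph.dist_eq_one_iff_adj.1 hl⟩
        exact ((Set.ncard_pos (toFinite _)).2 hmem).ne'
      simpa [hne] using e2 j (Finset.mem_univ j)
    | succ d ih =>
      intro j hj
      obtain ⟨l, hjl, hl⟩ := exists_adj_dist_eq hG (d := d + 2) hj
      have hlk : l ∈ kHop G k i := ⟨by omega, by have := j.2.2; omega⟩
      rw [hadj j ⟨l, hlk⟩ hjl]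
      exact ih ⟨l, hlk⟩ hl
  funext j
  exact hall (G.dist i j - 2) j (by have := j.2.1; omega)

lemma isUnit_obsMatrix {G : SimpleGraph V} (hG : G.Connected) (k : ℕ) (i : V) :
    IsUnit (obsMatrix G k i) := by
  classical
  rw [← Matrix.mulVec_injective_iff_isUnit]
  intro u v huv
  by_contra hne
  have h1 := obsMatrix_quadratic_pos hG k i (sub_ne_zero.2 hne)
  rw [mulVec_sub, show obsMatrix G k i *ᵥ u = obsMatrix G k i *ᵥ v from huv, sub_self,
    dotProduct_zero] at h1
  exact lt_irrefl _ h1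

/-- Disagreements inside their funnels keep the estimation errors below the bounds `δ`. -/
lemma abs_estimate_sub_lt {n : V → ℕ} {G : SimpleGraph V} (hG : G.Connected) {D : Design n}
    {Φ : Spec n} (hobs : D.ObserverOK Φ G) {t : ℝ} (ht : 0 ≤ t) {x : State n} {xhat : Estimates n}
    (h : InFunnels Φ G D t x xhat) {i j : V} (hj : j ∈ kHop G D.k i) (a : Fin (n i)) :
    |xhat j i a - x i a| < D.δ i j a t := by
  classical
  have hdet := (Matrix.isUnit_iff_isUnit_det _).1 (isUnit_obsMatrix hG D.k i)
  set M := obsMatrix G D.k i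
  set e : kHop G D.k i → ℝ := fun r => xhat r i a - x i a with he
  have h1 : e = M⁻¹ *ᵥ (M *ᵥ e) := by
    rw [mulVec_mulVec, nonsing_inv_mul _ hdet, one_mulVec]
  have h2 : e ⟨j, hj⟩ = ∑ r, M⁻¹ ⟨j, hj⟩ r * disagreement G D.k x xhat i r a := by
    conv_lhs => rw [h1]
    simp only [mulVec, dotProduct, disagreement_eq_mulVec, he, M]
  refine lt_of_lt_of_le ?_ (hobs.compat i ⟨j, hj⟩ a t ht)
  change |e ⟨j, hj⟩| < _
  rw [h2]
  refine (Finset.abs_sum_le_sum_abs _ _).trans_lt ?_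
  refine Finset.sum_lt_sum (fun r _ => ?_) ?_
  · rw [abs_mul]
    exact mul_le_mul_of_nonneg_left (h.observer i r r.2 a).le (abs_nonneg _)
  -- The bound is strict because a row of the inverse matrix cannot vanish.
  · by_contra! hcon
    have hzero : ∀ r, M⁻¹ ⟨j, hj⟩ r = 0 := fun r => by
      by_contra hne
      have := hcon r (Finset.mem_univ r)
      rw [abs_mul] at this
      exact absurd (le_of_mul_le_mul_left this (abs_pos.2 hne)) (not_le.2 (h.observer i r r.2 a))
    have h3 := congrFun (congrFun (nonsing_inv_mul M hdet) ⟨j, hj⟩) ⟨j, hj⟩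
    rw [Matrix.mul_apply, Finset.sum_eq_zero (fun r _ => by rw [hzero r, zero_mul]),
      one_apply_eq] at h3
    exact zero_ne_one h3

/-- A state estimated by `j` is estimated by a `k`-hop neighbor. -/
lemma mem_kHop_of_estimated {n : V → ℕ} {G : SimpleGraph V} (hG : G.Connected) {D : Design n}
    {Φ : Spec n} (hobs : D.ObserverOK Φ G) {i j : V} (h : i ∈ Φ.estimated G j) :
    j ∈ kHop G D.k i := by
  have h1 := hobs.hops j i h
  obtain ⟨-, hne, hadj⟩ := h
  have h0 : G.dist j i ≠ 0 := by
    rw [Ne, hG.dist_eq_zero_iff]; exact fun h => hne h.symm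
  have h2 : G.dist j i ≠ 1 := by
    rw [Ne, SimpleGraph.dist_eq_one_iff_adj]; exact hadj
  rw [SimpleGraph.dist_comm] at h0 h1 h2
  exact ⟨by omega, h1⟩

end Observer

/-! ### Positive robustness and satisfaction of formulas -/

section Semantics

variable {X : Type*}

lemma NonTemporal.holds_of_exactRobustness_pos {ψ : NonTemporal X} {x : X}
    (h : 0 < ψ.exactRobustness x) : ψ.Holds x := by
  induction ψ with
  | top => trivial
  | pred P => exact (EReal.coe_pos.1 h).le
  | notPred P => exact not_le.2 (neg_pos.1 (EReal.coe_pos.1 h))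
  | and ψ₁ ψ₂ ih₁ ih₂ => exact ⟨ih₁ (lt_min_iff.1 h).1, ih₂ (lt_min_iff.1 h).2⟩

lemma NonTemporal.expSum_nonneg (η : ℝ) (ψ : NonTemporal X) (x : X) : 0 ≤ ψ.expSum η x := by
  induction ψ with
  | top => exact le_rfl
  | pred P => exact (Real.exp_pos _).le
  | notPred P => exact (Real.exp_pos _).le
  | and ψ₁ ψ₂ ih₁ ih₂ => exact add_nonneg ih₁ ih₂

/-- The summands are nonnegative, so each is below `1`, which makes the robustness of each predicate
strictly positive; negated predicates need the strict sign. -/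
lemma NonTemporal.holds_of_expSum_lt_one {η : ℝ} (hη : 0 < η) {ψ : NonTemporal X} {x : X}
    (h : ψ.expSum η x < 1) : ψ.Holds x := by
  induction ψ with
  | top => trivial
  | pred P =>
    have := Real.exp_lt_one_iff.1 h
    change 0 ≤ P x
    nlinarith
  | notPred P =>
    have := Real.exp_lt_one_iff.1 h
    change ¬ 0 ≤ P x
    intro hP
    nlinarith
  | and ψ₁ ψ₂ ih₁ ih₂ =>
    have h' : ψ₁.expSum η x + ψ₂.expSum η x < 1 := h
    have := ψ₁.expSum_nonneg η x
    have := ψ₂.expSum_nonneg η x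
    exact ⟨ih₁ (by linarith), ih₂ (by linarith)⟩

/-- A formula of positive robustness holds. -/
lemma NonTemporal.holds_of_robustness_pos {s : Option ℝ} (hs : ∀ η ∈ s, 0 < η)
    {ψ : NonTemporal X} {x : X} (h : 0 < ψ.robustness s x) : ψ.Holds x := by
  cases s with
  | none =>
    refine holds_of_exactRobustness_pos ?_
    by_contra hle
    exact absurd (EReal.toReal_nonpos (not_lt.1 hle)) (not_le.2 h)
  | some η =>
    have hη := hs η rfl
    refine holds_of_expSum_lt_one hη ?_
    by_contra hle
    have h1 := Real.log_nonneg (not_lt.1 hle)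
    have h2 : 0 < -(1 / η) * Real.log (ψ.expSum η x) := h
    have : 0 < 1 / η := by positivity
    nlinarith

/-- A task is satisfied if its inner formula holds during its time window. -/
lemma Temporal.sat_of_window {φ : Temporal X} {tStar : ℝ} (ht : φ.AdmissibleTime tStar)
    {x : ℝ → X} (h : ∀ t ∈ φ.window tStar, φ.inner.Holds (x t)) : φ.Sat x 0 := by
  cases φ with
  | always a b ψ => intro t ht; exact h t (by simpa [Temporal.window] using ht)
  | eventually a b ψ => exact ⟨tStar, by simpa [Temporal.AdmissibleTime] using ht, h tStar rfl⟩
  | eventuallyAlways a₁ b₁ a₂ b₂ ψ =>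
    exact ⟨tStar, by simpa [Temporal.AdmissibleTime] using ht, fun t ht => h t ht⟩

lemma Temporal.nonneg_of_mem_window {φ : Temporal X} (hφ : φ.WellFormed) {tStar : ℝ}
    (ht : φ.AdmissibleTime tStar) {t : ℝ} (h : t ∈ φ.window tStar) : 0 ≤ t := by
  cases φ with
  | always a b ψ => exact hφ.1.trans h.1
  | eventually a b ψ => exact (mem_singleton_iff.1 h) ▸ hφ.1.trans ht.1
  | eventuallyAlways a₁ b₁ a₂ b₂ ψ =>
    exact (add_nonneg (hφ.1.1.trans ht.1) hφ.2.1).trans h.1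

end Semantics

/-! ### Induction along finite acyclic relations -/

lemma Acyclic.wellFounded {α : Type*} [Finite α] {r : α → α → Prop} (h : Acyclic r) :
    WellFounded r := by
  have : Std.Irrefl (Relation.TransGen r) := ⟨h⟩
  exact Subrelation.wf (fun hab => Relation.TransGen.single hab)
    (Finite.wellFounded_of_trans_of_irrefl (Relation.TransGen r))

/-- Induction from the targets of edges to their sources, the direction in which bounds on states
and velocities propagate. Vanishing of gradient weights uses the opposite direction. -/
lemma Acyclic.wellFounded_swap {α : Type*} [Finite α] {r : α → α → Prop} (h : Acyclic r) :
    WellFounded fun a b => r b a := by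
  refine Acyclic.wellFounded fun a ha => h a ?_
  exact Relation.transGen_swap.1 ha

/-! ### Regularity of performance functions -/

section PPF

open Filter Topology

lemma IsPPF.hasDerivWithinAt {ρ : ℝ → ℝ} (h : IsPPF ρ) {t : ℝ} (ht : 0 ≤ t) :
    HasDerivWithinAt ρ (derivWithin ρ (Ici 0) t) (Ici 0) t :=
  (h.contDiff.differentiableOn one_ne_zero t ht).hasDerivWithinAt

/-- Clamping the time at zero gives a function continuous on the whole line, so that the domain of
the closed-loop field can be open in `ℝ × E`, including at time `0`. -/
lemma IsPPF.continuous_max {ρ : ℝ → ℝ} (h : IsPPF ρ) : Continuous fun t => ρ (max t 0) :=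
  h.contDiff.continuousOn.comp_continuous (by fun_prop) fun t => le_max_right t 0

variable {V : Type*} [DecidableEq V] {n : V → ℕ}

/-- The modified funnel is continuously differentiable with bounded derivative. -/
lemma Design.FunnelsOK.exists_deriv_Γ {D : Design n} {Φ : Spec n} {G : SimpleGraph V}
    (h : D.FunnelsOK Φ G) (i : V) : ∃ Γ' : ℝ → ℝ, ∃ B,
      ∀ t, 0 ≤ t → HasDerivWithinAt (D.Γ i) (Γ' t) (Ici 0) t ∧ |Γ' t| ≤ B := by
  obtain ⟨B₁, hB₁⟩ := (h.γ_ppf i).deriv_bounded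
  rcases h.ρt_ppf i with h2 | ⟨-, h2⟩
  · obtain ⟨B₂, hB₂⟩ := h2.deriv_bounded
    refine ⟨_, B₁ + B₂, fun t ht => ⟨((h.γ_ppf i).hasDerivWithinAt ht).fun_sub
      (h2.hasDerivWithinAt ht), ?_⟩⟩
    exact (abs_sub _ _).trans (add_le_add (hB₁ t ht) (hB₂ t ht))
  · refine ⟨_, B₁, fun t ht => ⟨((h.γ_ppf i).hasDerivWithinAt ht).congr (fun s hs => ?_) ?_,
      hB₁ t ht⟩⟩
    · rw [Design.Γ, h2 s hs, sub_zero]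
    · rw [Design.Γ, h2 t ht, sub_zero]

lemma Design.FunnelsOK.continuousOn_Γ {D : Design n} {Φ : Spec n} {G : SimpleGraph V}
    (h : D.FunnelsOK Φ G) (i : V) : ContinuousOn (D.Γ i) (Ici 0) := by
  obtain ⟨Γ', B, hΓ⟩ := h.exists_deriv_Γ i
  exact fun t ht => (hΓ t ht).1.continuousWithinAt

lemma Design.FunnelsOK.Γ_le_γ {D : Design n} {Φ : Spec n} {G : SimpleGraph V}
    (h : D.FunnelsOK Φ G) (i : V) {t : ℝ} (ht : 0 ≤ t) : D.Γ i t ≤ D.γ i t := by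
  rw [Design.Γ, sub_le_self_iff]
  rcases h.ρt_ppf i with h2 | ⟨-, h2⟩
  · exact (h2.pos t ht).le
  · exact (h2 t ht).ge

end PPF

/-! ### Differential properties of the robustness functions -/

section Robustness

open Filter Topology

variable {V : Type*} [DecidableEq V] {n : V → ℕ} {Φ : Spec n}

/-- The upper funnel bound `ρmax` lies below the supremum, so the funnel avoids the maximum points,
the only places where smoothness may fail or the own gradient may vanish. -/
lemma Design.FunnelsOK.not_isMaxOn {D : Design n} {G : SimpleGraph V} (h : D.FunnelsOK Φ G) {i : V}
    {x : State n} (hx : Φ.rho i x ≤ D.ρmax i) : ¬ IsMaxOn (Φ.rho i) univ x := fun hmax => by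
  obtain ⟨y, hy⟩ := h.ρmax_lt i
  exact absurd (hmax (mem_univ y)) (not_le.2 (hx.trans_lt hy))

/-- A task neighbor that communicates is in the same cluster. Hence a task sees other clusters only
through estimates. -/
lemma Spec.mem_estimated_of_taskEdge {G : SimpleGraph V} {i l : V}
    (hl : Φ.clusterOf G l ≠ Φ.clusterOf G i) (he : Φ.TaskEdge i l) : l ∈ Φ.estimated G i := by
  have hne : l ≠ i := fun h => hl (by rw [h])
  refine ⟨Or.inl he, hne, fun hadj => hl ?_⟩
  refine SimpleGraph.ConnectedComponent.sound (SimpleGraph.Adj.reachable ?_)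
  exact ⟨hadj.symm, hne, Or.inr he⟩

variable [Fintype V]

lemma fderiv_apply_eq_sum_partialDeriv (F : State n → ℝ) (x v : State n) :
    fderiv ℝ F x v = ∑ l, ∑ a, partialDeriv F l a x * v l a := by
  have hv : v = ∑ l, ∑ a, v l a • (Pi.single l (Pi.single a 1) : State n) := by
    funext l a
    simp only [Finset.sum_apply, Pi.smul_apply, smul_eq_mul]
    rw [Finset.sum_eq_single l, Finset.sum_eq_single a]
    · simp
    · intro b _ hb
      simp [hb.symm]
    · simp
    · intro k _ hk
      simp [hk.symm]
    · simp
  conv_lhs => rw [hv]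
  simp only [map_sum, map_smul, smul_eq_mul, partialDeriv]
  exact Finset.sum_congr rfl fun l _ => Finset.sum_congr rfl fun a _ => mul_comm _ _

lemma GoodRobustness.continuous {i : V} (h : GoodRobustness Φ i) : Continuous (Φ.rho i) :=
  continuousOn_univ.1 (h.concave.continuousOn isOpen_univ)

lemma GoodRobustness.continuousAt_partialDeriv {i : V} (h : GoodRobustness Φ i) {x : State n}
    (hx : ¬ IsMaxOn (Φ.rho i) univ x) (l : V) (a : Fin (n l)) :
    ContinuousAt (partialDeriv (Φ.rho i) l a) x :=
  ((h.smooth x hx).fderiv_right (m := 0) (by simp)).continuousAt.clm_apply continuousAt_const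

lemma Spec.partialDeriv_eq_zero {i l : V} (h : ¬ Φ.TaskEdge i l) (a : Fin (n l)) (x : State n) :
    partialDeriv (Φ.rho i) l a x = 0 := by
  by_cases hd : DifferentiableAt ℝ (Φ.rho i) x
  · have h1 := hd.hasFDerivAt.hasLineDerivAt (Pi.single l (Pi.single a 1))
    have hconst : (fun t : ℝ => Φ.rho i (x + t • (Pi.single l (Pi.single a 1) : State n))) =
        fun _ => Φ.rho i x := by
      funext t
      have hupd : x + t • (Pi.single l (Pi.single a 1) : State n) =
          Function.update x l (x l + t • Pi.single a 1) := by
        funext k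
        rcases eq_or_ne k l with rfl | hk
        · simp
        · simp [hk]
      rw [hupd]
      by_contra hne
      exact h ⟨x, _, hne⟩
    rw [HasLineDerivAt, hconst] at h1
    exact h1.unique (hasDerivAt_const _ _)
  · rw [partialDeriv, fderiv_zero_of_not_differentiableAt hd]; rfl

/-- Task neighbors are estimated exactly if they belong to a different cluster. -/
lemma Spec.Admissible.not_mem_estimated {G : SimpleGraph V} (h : Φ.Admissible G) {i l : V}
    (hl : Φ.clusterOf G l = Φ.clusterOf G i) : l ∉ Φ.estimated G i := fun hmem => by
  rcases h.cluster_comm i l hmem.1 hl with h1 | h1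
  · exact hmem.2.1 h1
  · exact hmem.2.2 h1

end Robustness

/-! ### The closed loop as an ODE on an open set -/

section Field

open Filter Topology Matrix

set_option linter.unusedSectionVars false

variable {V : Type*} [Fintype V] [DecidableEq V] {n m : V → ℕ}

/-- Right-hand side of the controlled agent `i`. -/
noncomputable def agentRate (A : Agents n m) (Φ : Spec n) (G : SimpleGraph V) (D : Design n) (t : ℝ)
    (x : State n) (xhat : Estimates n) (i : V) : Fin (n i) → ℝ :=
  A.f i (x i) + (A.g i (x i)).mulVec (controlInput A Φ G D t x xhat i) + A.w i x t

open Classical in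
/-- Right-hand side of the closed loop. Estimates that belong to no observer are kept constant, and the
time is replaced by its positive part. -/
noncomputable def closedLoop (A : Agents n m) (Φ : Spec n) (G : SimpleGraph V) (D : Design n) (t : ℝ)
    (p : State n × Estimates n) : State n × Estimates n :=
  (fun i => agentRate A Φ G D (max t 0) p.1 p.2 i,
    fun j i a => if j ∈ kHop G D.k i then observerRate G D (max t 0) p.1 p.2 i j a else 0)

/-- Times and states inside the funnels. -/
def funnelSet (Φ : Spec n) (G : SimpleGraph V) (D : Design n) : Set (ℝ × (State n × Estimates n)) :=
  {z | InFunnels Φ G D (max z.1 0) z.2.1 z.2.2}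

variable {A : Agents n m} {Φ : Spec n} {G : SimpleGraph V} {D : Design n}

lemma continuous_taskState (i : V) :
    Continuous fun p : State n × Estimates n => taskState Φ G p.1 p.2 i := by
  refine continuous_pi fun j => ?_
  simp only [taskState]
  split_ifs <;> fun_prop

lemma continuous_disagreement (k : ℕ) (i j : V) (a : Fin (n i)) :
    Continuous fun p : State n × Estimates n => disagreement G k p.1 p.2 i j a := by
  unfold disagreement
  fun_prop

lemma Design.FunnelsOK.continuous_Γ (hfun : D.FunnelsOK Φ G) (i : V) :
    Continuous fun t => D.Γ i (max t 0) :=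
  (hfun.continuousOn_Γ i).comp_continuous (by fun_prop) fun t => le_max_right t 0

lemma continuous_normError (hΦ : Φ.Admissible G) (hfun : D.FunnelsOK Φ G) (i : V) :
    Continuous fun z : ℝ × (State n × Estimates n) =>
      normError Φ G D (max z.1 0) z.2.1 z.2.2 i := by
  unfold normError
  refine Continuous.mul (((hfun.continuous_Γ i).comp continuous_fst).inv₀ fun z =>
    (hfun.Γ_pos i _ (le_max_right _ _)).ne') ?_
  exact (((hΦ.robustness i).continuous.comp (continuous_taskState i)).comp continuous_snd).sub
    continuous_const

lemma continuous_normDisagreement (hobs : D.ObserverOK Φ G) {i j : V} (hj : j ∈ kHop G D.k i)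
    (a : Fin (n i)) :
    Continuous fun z : ℝ × (State n × Estimates n) =>
      normDisagreement G D (max z.1 0) z.2.1 z.2.2 i j a := by
  unfold normDisagreement
  have h := hobs.obsFunnel_ppf i j hj a
  exact ((h.continuous_max.comp continuous_fst).inv₀ fun z =>
    (h.pos _ (le_max_right _ _)).ne').mul ((continuous_disagreement D.k i j a).comp continuous_snd)

lemma normError_mem_Ioo_iff {t : ℝ} {x : State n} {xhat : Estimates n} {i : V}
    (h : 0 < D.Γ i t) : normError Φ G D t x xhat i ∈ Ioo (-1 : ℝ) 0 ↔
      -D.Γ i t < Φ.rho i (taskState Φ G x xhat i) - D.ρmax i ∧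
        Φ.rho i (taskState Φ G x xhat i) - D.ρmax i < 0 := by
  rw [normError, ← div_eq_inv_mul, mem_Ioo, lt_div_iff₀ h, div_lt_iff₀ h, zero_mul, neg_one_mul]

lemma normDisagreement_mem_Ioo_iff {t : ℝ} {x : State n} {xhat : Estimates n} {i j : V}
    {a : Fin (n i)} (h : 0 < D.obsFunnel i j a t) :
    normDisagreement G D t x xhat i j a ∈ Ioo (-1 : ℝ) 1 ↔
      |disagreement G D.k x xhat i j a| < D.obsFunnel i j a t := by
  rw [normDisagreement, ← div_eq_inv_mul, mem_Ioo, lt_div_iff₀ h, div_lt_iff₀ h, one_mul,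
    neg_one_mul, abs_lt]

lemma inFunnels_iff (hobs : D.ObserverOK Φ G) (hfun : D.FunnelsOK Φ G) {t : ℝ} (ht : 0 ≤ t)
    {x : State n} {xhat : Estimates n} : InFunnels Φ G D t x xhat ↔
      (∀ i, normError Φ G D t x xhat i ∈ Ioo (-1 : ℝ) 0) ∧
      ∀ i, ∀ j : kHop G D.k i, ∀ a, normDisagreement G D t x xhat i j a ∈ Ioo (-1 : ℝ) 1 := by
  constructor
  · intro h
    exact ⟨fun i => (normError_mem_Ioo_iff (hfun.Γ_pos i t ht)).2 (h.task i), fun i j a =>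
      (normDisagreement_mem_Ioo_iff ((hobs.obsFunnel_ppf i j j.2 a).pos t ht)).2
        (h.observer i j j.2 a)⟩
  · intro h
    exact ⟨fun i => (normError_mem_Ioo_iff (hfun.Γ_pos i t ht)).1 (h.1 i), fun i j hj a =>
      (normDisagreement_mem_Ioo_iff ((hobs.obsFunnel_ppf i j hj a).pos t ht)).1
        (h.2 i ⟨j, hj⟩ a)⟩

lemma isOpen_funnelSet (hΦ : Φ.Admissible G) (hobs : D.ObserverOK Φ G) (hfun : D.FunnelsOK Φ G) :
    IsOpen (funnelSet Φ G D) := by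
  have h : funnelSet Φ G D =
      (⋂ i, (fun z : ℝ × (State n × Estimates n) =>
        normError Φ G D (max z.1 0) z.2.1 z.2.2 i) ⁻¹' Ioo (-1 : ℝ) 0) ∩
      ⋂ i, ⋂ j : kHop G D.k i, ⋂ a, (fun z : ℝ × (State n × Estimates n) =>
        normDisagreement G D (max z.1 0) z.2.1 z.2.2 i j a) ⁻¹' Ioo (-1 : ℝ) 1 := by
    ext z
    simp only [mem_inter_iff, mem_iInter, mem_preimage]
    exact inFunnels_iff hobs hfun (le_max_right _ _)
  rw [h]
  refine IsOpen.inter (isOpen_iInter_of_finite fun i =>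
    isOpen_Ioo.preimage (continuous_normError hΦ hfun i)) ?_
  exact isOpen_iInter_of_finite fun i => isOpen_iInter_of_finite fun j =>
    isOpen_iInter_of_finite fun a => isOpen_Ioo.preimage (continuous_normDisagreement hobs j.2 a)

lemma continuousAt_obsJac {e : ℝ} (he : e ∈ Ioo (-1 : ℝ) 1) : ContinuousAt obsJac e := by
  unfold obsJac
  refine ContinuousAt.div (by fun_prop) (by fun_prop) ?_
  nlinarith [he.1, he.2]

lemma continuousAt_taskJac {e : ℝ} (he : e ∈ Ioo (-1 : ℝ) 0) : ContinuousAt taskJac e := by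
  unfold taskJac
  refine ContinuousAt.div (by fun_prop) (by fun_prop) ?_
  exact mul_ne_zero he.2.ne (by linarith [he.1])

lemma continuousOn_closedLoop (hA : A.Regular) (hΦ : Φ.Admissible G) (hobs : D.ObserverOK Φ G)
    (hfun : D.FunnelsOK Φ G) :
    ContinuousOn (fun z : ℝ × (State n × Estimates n) => closedLoop A Φ G D z.1 z.2)
      (funnelSet Φ G D) := by
  intro z hz
  refine ContinuousAt.continuousWithinAt ?_
  have hz' := (inFunnels_iff hobs hfun (le_max_right _ _)).1 hz
  refine ContinuousAt.prodMk (continuousAt_pi.2 fun i => ?_)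
    (continuousAt_pi.2 fun j => continuousAt_pi.2 fun i => continuousAt_pi.2 fun a => ?_)
  · have hf : ContinuousAt (fun z : ℝ × (State n × Estimates n) => A.f i (z.2.1 i)) z :=
      ((hA.f_lipschitz i).continuous.comp (by fun_prop :
        Continuous fun z : ℝ × (State n × Estimates n) => z.2.1 i)).continuousAt
    have hw : Continuous fun z : ℝ × (State n × Estimates n) => A.w i z.2.1 (max z.1 0) :=
      (hA.w_continuous i).comp_continuous
        (by fun_prop : Continuous fun z : ℝ × (State n × Estimates n) => (z.2.1, max z.1 0))
        fun z => ⟨mem_univ _, le_max_right z.1 0⟩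
    have hg : ∀ a b, ContinuousAt (fun z : ℝ × (State n × Estimates n) => A.g i (z.2.1 i) a b) z :=
      fun a b => ((hA.g_lipschitz i a b).continuous.comp (by fun_prop :
        Continuous fun z : ℝ × (State n × Estimates n) => z.2.1 i)).continuousAt
    have hΓ : ∀ j, ContinuousAt (fun z : ℝ × (State n × Estimates n) => (D.Γ j (max z.1 0))⁻¹) z :=
      fun j => (((hfun.continuous_Γ j).comp continuous_fst).inv₀ fun z =>
        (hfun.Γ_pos j _ (le_max_right _ _)).ne').continuousAt
    -- Inside the funnel the task state is not a maximum point, so the gradient of the robustness is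
    -- continuous there.
    have hP : ∀ j a, ContinuousAt (fun z : ℝ × (State n × Estimates n) =>
        partialDeriv (Φ.rho j) i a (taskState Φ G z.2.1 z.2.2 j)) z := fun j a =>
      ContinuousAt.comp (f := fun z : ℝ × (State n × Estimates n) => taskState Φ G z.2.1 z.2.2 j)
        ((hΦ.robustness j).continuousAt_partialDeriv
          (hfun.not_isMaxOn (sub_neg.1 (hz.task j).2).le) i a)
        ((continuous_taskState j).comp continuous_snd).continuousAt
    have hJ : ∀ j, ContinuousAt (fun z : ℝ × (State n × Estimates n) =>
        taskJac (normError Φ G D (max z.1 0) z.2.1 z.2.2 j)) z := fun j =>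
      ContinuousAt.comp (f := fun z : ℝ × (State n × Estimates n) =>
        normError Φ G D (max z.1 0) z.2.1 z.2.2 j) (continuousAt_taskJac (hz'.1 j))
        (continuous_normError hΦ hfun j).continuousAt
    have hτ : ∀ j, ContinuousAt (fun z : ℝ × (State n × Estimates n) =>
        taskTrans (normError Φ G D (max z.1 0) z.2.1 z.2.2 j)) z := fun j =>
      ContinuousAt.comp (f := fun z : ℝ × (State n × Estimates n) =>
        normError Φ G D (max z.1 0) z.2.1 z.2.2 j) (hasDerivAt_taskTrans (hz'.1 j)).continuousAt
        (continuous_normError hΦ hfun j).continuousAt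
    refine (hf.add (continuousAt_pi.2 fun a => ?_)).add hw.continuousAt
    simp only [mulVec, dotProduct, controlInput, Pi.neg_apply, transpose_apply]
    refine tendsto_finsetSum _ fun b _ => (hg a b).mul (ContinuousAt.neg ?_)
    refine tendsto_finsetSum _ fun c _ => (hg c b).mul ?_
    exact tendsto_finsetSum _ fun j _ => (((hP j c).mul (hΓ j)).mul (hJ j)).mul (hτ j)
  · by_cases hj : j ∈ kHop G D.k i
    · simp only [if_pos hj, observerRate]
      have he := (continuous_normDisagreement hobs hj a).continuousAt (x := z)
      have hmem := hz'.2 i ⟨j, hj⟩ a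
      have hr := hobs.obsFunnel_ppf i j hj a
      refine ContinuousAt.neg ((ContinuousAt.mul ?_ ?_).mul ?_)
      · exact ((hr.continuous_max.comp continuous_fst).inv₀ fun z =>
          (hr.pos _ (le_max_right _ _)).ne').continuousAt
      · exact ContinuousAt.comp (f := fun z : ℝ × (State n × Estimates n) =>
          normDisagreement G D (max z.1 0) z.2.1 z.2.2 i j a) (continuousAt_obsJac hmem) he
      · exact ContinuousAt.comp (f := fun z : ℝ × (State n × Estimates n) =>
          normDisagreement G D (max z.1 0) z.2.1 z.2.2 i j a)
          (hasDerivAt_obsTrans hmem).continuousAt he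
    · simp only [if_neg hj]
      exact continuousAt_const

/-- The evolution of the closed loop only depends on the estimates of the observers. -/
lemma taskState_congr (hG : G.Connected) (hobs : D.ObserverOK Φ G) {x : State n}
    {xhat xhat' : Estimates n} (h : ∀ i, ∀ j ∈ kHop G D.k i, ∀ a, xhat j i a = xhat' j i a) :
    taskState Φ G x xhat = taskState Φ G x xhat' := by
  funext i j a
  by_cases hj : j ∈ Φ.estimated G i
  · simp only [taskState, if_pos hj]
    exact h j i (mem_kHop_of_estimated hG hobs hj) a
  · simp only [taskState, if_neg hj]

lemma disagreement_congr {x : State n}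
    {xhat xhat' : Estimates n} (h : ∀ i, ∀ j ∈ kHop G D.k i, ∀ a, xhat j i a = xhat' j i a)
    {i j : V} (hj : j ∈ kHop G D.k i) (a : Fin (n i)) :
    disagreement G D.k x xhat i j a = disagreement G D.k x xhat' i j a := by
  classical
  unfold disagreement
  rw [h i j hj a]
  congr 1
  refine Finset.sum_congr rfl fun l hl => ?_
  rw [Finset.mem_filter] at hl
  rw [h i l hl.2.2 a]

lemma observerRate_congr {t : ℝ} {x : State n}
    {xhat xhat' : Estimates n} (h : ∀ i, ∀ j ∈ kHop G D.k i, ∀ a, xhat j i a = xhat' j i a)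
    {i j : V} (hj : j ∈ kHop G D.k i) (a : Fin (n i)) :
    observerRate G D t x xhat i j a = observerRate G D t x xhat' i j a := by
  simp only [observerRate, normDisagreement, disagreement_congr h hj]

lemma agentRate_congr (hG : G.Connected) (hobs : D.ObserverOK Φ G) {t : ℝ} {x : State n}
    {xhat xhat' : Estimates n} (h : ∀ i, ∀ j ∈ kHop G D.k i, ∀ a, xhat j i a = xhat' j i a) :
    agentRate A Φ G D t x xhat = agentRate A Φ G D t x xhat' := by
  funext i
  simp only [agentRate, controlInput, normError, taskState_congr hG hobs h]

lemma InFunnels.congr (hG : G.Connected) (hobs : D.ObserverOK Φ G) {t : ℝ} {x : State n}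
    {xhat xhat' : Estimates n} (h : ∀ i, ∀ j ∈ kHop G D.k i, ∀ a, xhat j i a = xhat' j i a)
    (hin : InFunnels Φ G D t x xhat) : InFunnels Φ G D t x xhat' := by
  refine ⟨fun i => ?_, fun i j hj a => ?_⟩
  · rw [← taskState_congr hG hobs h]; exact hin.task i
  · rw [← disagreement_congr h hj]; exact hin.observer i j hj a

lemma SolvesOn.isSolution {I : Set ℝ} (hI : I ⊆ Ici 0) {p : ℝ → State n × Estimates n}
    (hp : SolvesOn (closedLoop A Φ G D) I p) :
    IsSolution A Φ G D I (fun t => (p t).1) (fun t => (p t).2) := by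
  refine ⟨fun t ht i => ?_, fun t ht i j hj a => ?_⟩
  · have h1 := (hp t ht).fst
    have h2 := hasDerivWithinAt_pi.1 h1 i
    simp only [closedLoop, max_eq_left (show 0 ≤ t from hI ht)] at h2
    exact h2
  · have h1 := (hp t ht).snd
    have h2 := hasDerivWithinAt_pi.1 (hasDerivWithinAt_pi.1 (hasDerivWithinAt_pi.1 h1 j) i) a
    simpa only [closedLoop, max_eq_left (show 0 ≤ t from hI ht), if_pos hj] using h2

open Classical in
/-- Replace the estimates that belong to no observer by those of `xhat₀`. -/
noncomputable def maskEstimates (G : SimpleGraph V) (k : ℕ) (xhat₀ xhat : Estimates n) : Estimates n :=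
  fun j i a => if j ∈ kHop G k i then xhat j i a else xhat₀ j i a

lemma maskEstimates_of_mem {k : ℕ} {xhat₀ xhat : Estimates n} {i j : V} (hj : j ∈ kHop G k i)
    (a : Fin (n i)) : maskEstimates G k xhat₀ xhat j i a = xhat j i a := if_pos hj

lemma maskEstimates_self (k : ℕ) (xhat : Estimates n) : maskEstimates G k xhat xhat = xhat := by
  funext j i a
  simp [maskEstimates]

/-- `IsSolution` does not constrain the entries held by no observer, which may even fail to be
differentiable. Freezing them at `xhat₀` leaves the dynamics unchanged and solves the ODE in all
coordinates. -/
lemma IsSolution.solvesOn (hG : G.Connected) (hobs : D.ObserverOK Φ G) {I : Set ℝ} (hI : I ⊆ Ici 0)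
    {x : ℝ → State n} {xhat : ℝ → Estimates n} (h : IsSolution A Φ G D I x xhat)
    (xhat₀ : Estimates n) :
    SolvesOn (closedLoop A Φ G D) I fun t => (x t, maskEstimates G D.k xhat₀ (xhat t)) := by
  intro t ht
  have hmask : ∀ i, ∀ j ∈ kHop G D.k i, ∀ a,
      xhat t j i a = maskEstimates G D.k xhat₀ (xhat t) j i a :=
    fun i j hj a => (maskEstimates_of_mem hj a).symm
  refine HasDerivWithinAt.prodMk (hasDerivWithinAt_pi.2 fun i => ?_) (hasDerivWithinAt_pi.2 fun j =>
    hasDerivWithinAt_pi.2 fun i => hasDerivWithinAt_pi.2 fun a => ?_)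
  · have := h.agents t ht i
    rw [max_eq_left (show 0 ≤ t from hI ht), ← agentRate_congr hG hobs hmask]
    exact this
  · by_cases hj : j ∈ kHop G D.k i
    · rw [max_eq_left (show 0 ≤ t from hI ht), if_pos hj, ← observerRate_congr hmask hj]
      simpa only [maskEstimates_of_mem hj] using h.observers t ht i j hj a
    · simp only [if_neg hj, maskEstimates]
      exact hasDerivWithinAt_const _ _ _

end Field

/-! ### Calculus of bounded functions of time -/

section Bounded

/-- Boundedness of a real function on a set of times. -/
def AbsBoundedOn (I : Set ℝ) (h : ℝ → ℝ) : Prop := ∃ B, ∀ t ∈ I, |h t| ≤ B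

variable {I : Set ℝ} {h h₁ h₂ : ℝ → ℝ}

lemma AbsBoundedOn.of_abs_le (h₁b : AbsBoundedOn I h₁) (hle : ∀ t ∈ I, |h t| ≤ |h₁ t|) :
    AbsBoundedOn I h :=
  let ⟨B, hB⟩ := h₁b
  ⟨B, fun t ht => (hle t ht).trans (hB t ht)⟩

lemma AbsBoundedOn.congr (h₁b : AbsBoundedOn I h₁) (hle : ∀ t ∈ I, h t = h₁ t) :
    AbsBoundedOn I h :=
  h₁b.of_abs_le fun t ht => (congrArg abs (hle t ht)).le

lemma absBoundedOn_const (c : ℝ) : AbsBoundedOn I fun _ => c := ⟨|c|, fun _ _ => le_rfl⟩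

lemma AbsBoundedOn.add (h₁b : AbsBoundedOn I h₁) (h₂b : AbsBoundedOn I h₂) :
    AbsBoundedOn I fun t => h₁ t + h₂ t :=
  let ⟨B₁, hB₁⟩ := h₁b
  let ⟨B₂, hB₂⟩ := h₂b
  ⟨B₁ + B₂, fun t ht => (abs_add_le _ _).trans (add_le_add (hB₁ t ht) (hB₂ t ht))⟩

lemma AbsBoundedOn.neg (hb : AbsBoundedOn I h) : AbsBoundedOn I fun t => -h t :=
  hb.of_abs_le fun _ _ => (abs_neg _).le

lemma AbsBoundedOn.mul (h₁b : AbsBoundedOn I h₁) (h₂b : AbsBoundedOn I h₂) :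
    AbsBoundedOn I fun t => h₁ t * h₂ t := by
  obtain ⟨B₁, hB₁⟩ := h₁b
  obtain ⟨B₂, hB₂⟩ := h₂b
  refine ⟨B₁ * B₂, fun t ht => ?_⟩
  rw [abs_mul]
  exact mul_le_mul (hB₁ t ht) (hB₂ t ht) (abs_nonneg _) ((abs_nonneg _).trans (hB₁ t ht))

lemma AbsBoundedOn.sum {ι : Type*} {s : Finset ι} {h : ι → ℝ → ℝ}
    (hb : ∀ j ∈ s, AbsBoundedOn I (h j)) : AbsBoundedOn I fun t => ∑ j ∈ s, h j t := by
  classical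
  induction s using Finset.induction_on with
  | empty => simpa using absBoundedOn_const 0
  | insert j s hj ih =>
    simp only [Finset.sum_insert hj]
    exact (hb j (Finset.mem_insert_self j s)).add
      (ih fun i hi => hb i (Finset.mem_insert_of_mem hi))

lemma AbsBoundedOn.comp_compact {α : Type*} [TopologicalSpace α] {K : Set α} (hK : IsCompact K)
    {F : α → ℝ} (hF : ContinuousOn F K) {y : ℝ → α} (hy : ∀ t ∈ I, y t ∈ K) :
    AbsBoundedOn I fun t => F (y t) := by
  obtain ⟨B, hB⟩ := hK.exists_bound_of_continuousOn hF
  exact ⟨B, fun t ht => hB _ (hy t ht)⟩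

lemma exists_uniform_absBound {ι : Type*} [Finite ι] {h : ι → ℝ → ℝ}
    (hb : ∀ j, AbsBoundedOn I (h j)) : ∃ B, 0 ≤ B ∧ ∀ j, ∀ t ∈ I, |h j t| ≤ B := by
  choose B hB using hb
  obtain ⟨M, hM⟩ := Finite.exists_le B
  exact ⟨max M 0, le_max_right _ _, fun j t ht => ((hB j t ht).trans (hM j)).trans (le_max_left _ _)⟩

lemma IsPPF.absBoundedOn {ρ : ℝ → ℝ} (hρ : IsPPF ρ) (hI : I ⊆ Ici 0) : AbsBoundedOn I ρ := by
  obtain ⟨B, hB⟩ := hρ.bounded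
  refine ⟨B, fun t ht => ?_⟩
  rw [abs_of_pos (hρ.pos t (hI ht))]
  exact hB t (hI ht)

/-- A positive continuous function is bounded below on the compact interval `[0, T]`; the bound may
degrade as `T` grows. -/
lemma absBoundedOn_inv {ρ : ℝ → ℝ} {T : ℝ} (hc : ContinuousOn ρ (Ici 0)) (hpos : ∀ t, 0 ≤ t → 0 < ρ t) :
    AbsBoundedOn (Ico 0 T) fun t => (ρ t)⁻¹ :=
  AbsBoundedOn.comp_compact (y := id) (isCompact_Icc (a := 0) (b := T))
    ((hc.mono Icc_subset_Ici_self).inv₀ fun t ht => (hpos t ht.1).ne')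
    fun _ ht => Ico_subset_Icc_self ht

end Bounded

/-! ### A priori bounds and coercivity of the feedback -/

section APriori

open Filter Topology Matrix

set_option linter.unusedSectionVars false

variable {V : Type*} [Fintype V] [DecidableEq V] {n m : V → ℕ}
  {A : Agents n m} {Φ : Spec n} {G : SimpleGraph V} {D : Design n}
  {I : Set ℝ} {x : ℝ → State n} {xhat : ℝ → Estimates n}

lemma absBoundedOn_estimate (hG : G.Connected) (hobs : D.ObserverOK Φ G) (hI : I ⊆ Ici 0)
    (hin : ∀ t ∈ I, InFunnels Φ G D t (x t) (xhat t)) {i j : V} (hj : j ∈ kHop G D.k i)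
    {a : Fin (n i)} (hx : AbsBoundedOn I fun t => x t i a) :
    AbsBoundedOn I fun t => xhat t j i a := by
  have h1 : AbsBoundedOn I fun t => xhat t j i a - x t i a := by
    refine ((hobs.δ_ppf i j hj a).absBoundedOn hI).of_abs_le fun t ht => ?_
    exact (abs_estimate_sub_lt hG hobs (hI ht) (hin t ht) hj a).le.trans (le_abs_self _)
  exact (h1.add hx).congr fun t _ => by ring

lemma absBoundedOn_taskState_of (hG : G.Connected) (hobs : D.ObserverOK Φ G) (hI : I ⊆ Ici 0)
    (hin : ∀ t ∈ I, InFunnels Φ G D t (x t) (xhat t)) (i : V) {l : V} {a : Fin (n l)}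
    (hx : AbsBoundedOn I fun t => x t l a) :
    AbsBoundedOn I fun t => taskState Φ G (x t) (xhat t) i l a := by
  by_cases hl : l ∈ Φ.estimated G i
  · simp only [taskState, if_pos hl]
    exact absBoundedOn_estimate hG hobs hI hin (mem_kHop_of_estimated hG hobs hl) hx
  · simpa only [taskState, if_neg hl] using hx

/-- States inside the funnels are bounded, by well-posedness along the acyclic task graph. -/
lemma absBoundedOn_state (hG : G.Connected) (hΦ : Φ.Admissible G) (hobs : D.ObserverOK Φ G)
    (hfun : D.FunnelsOK Φ G) (hI : I ⊆ Ici 0)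
    (hin : ∀ t ∈ I, InFunnels Φ G D t (x t) (xhat t)) (i : V) :
    ∀ a, AbsBoundedOn I fun t => x t i a := by
  induction i using hΦ.acyclic.wellFounded_swap.induction with
  | _ i ih =>
  intro a
  obtain ⟨R, -, hR⟩ := exists_uniform_absBound (I := I)
    (ι := Σ j : {j // i ≠ j ∧ Φ.TaskEdge i j}, Fin (n j))
    (h := fun q t => taskState Φ G (x t) (xhat t) i q.1 q.2) fun q =>
      absBoundedOn_taskState_of hG hobs hI hin i (ih q.1 q.1.2 q.2)
  -- The funnel gives `ρ_i > ρmax - Γ ≥ ρmax - γ ≥ ρmax - C`, so well-posedness applies at the task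
  -- state. Its `i`-th component is the true state, since no agent estimates itself.
  obtain ⟨C, hC⟩ := (hfun.γ_ppf i).bounded
  obtain ⟨B, hB⟩ := (hΦ.robustness i).wellPosed (D.ρmax i - C) R
  refine ⟨B, fun t ht => ?_⟩
  have h1 := hB (taskState Φ G (x t) (xhat t) i) ?_ (fun j hj hne b => ?_) a
  · have hi : i ∉ Φ.estimated G i := hΦ.not_mem_estimated rfl
    simpa only [taskState, if_neg hi] using h1
  · have := ((hin t ht).task i).1
    have := hfun.Γ_le_γ i (hI ht)
    have := hC t (hI ht)
    linarith
  · exact hR ⟨⟨j, hne.symm, hj.resolve_right hne⟩, b⟩ t ht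

/-- States `x` and task states `y` below the bounds `ρmax` on the robustness, of norm at most `R`. -/
def boundedRegion (Φ : Spec n) (D : Design n) (R : ℝ) : Set (State n × (V → State n)) :=
  Metric.closedBall 0 R ∩ {y | ∀ i, Φ.rho i (y.2 i) ≤ D.ρmax i}

lemma isCompact_boundedRegion (hΦ : Φ.Admissible G) (R : ℝ) : IsCompact (boundedRegion Φ D R) := by
  refine (isCompact_closedBall _ _).inter_right ?_
  rw [ofPred_forall]
  refine isClosed_iInter fun i => isClosed_le ?_ continuous_const
  exact (hΦ.robustness i).continuous.comp (by fun_prop)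

lemma exists_mem_boundedRegion (hG : G.Connected) (hΦ : Φ.Admissible G) (hobs : D.ObserverOK Φ G)
    (hfun : D.FunnelsOK Φ G) (hI : I ⊆ Ici 0)
    (hin : ∀ t ∈ I, InFunnels Φ G D t (x t) (xhat t)) :
    ∃ R, ∀ t ∈ I, (x t, taskState Φ G (x t) (xhat t)) ∈ boundedRegion Φ D R := by
  have hx := absBoundedOn_state hG hΦ hobs hfun hI hin
  obtain ⟨R₁, h₁, hR₁⟩ := exists_uniform_absBound (I := I) (ι := Σ i, Fin (n i))
    (h := fun q t => x t q.1 q.2) fun q => hx q.1 q.2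
  obtain ⟨R₂, h₂, hR₂⟩ := exists_uniform_absBound (I := I) (ι := V × Σ i, Fin (n i))
    (h := fun q t => taskState Φ G (x t) (xhat t) q.1 q.2.1 q.2.2) fun q =>
      absBoundedOn_taskState_of hG hobs hI hin q.1 (hx q.2.1 q.2.2)
  refine ⟨max R₁ R₂, fun t ht => ⟨?_, fun i => (sub_neg.1 ((hin t ht).task i).2).le⟩⟩
  rw [mem_closedBall_zero_iff, Prod.norm_def]
  refine max_le_max ((pi_norm_le_iff_of_nonneg h₁).2 fun i => (pi_norm_le_iff_of_nonneg h₁).2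
    fun a => hR₁ ⟨i, a⟩ t ht) ((pi_norm_le_iff_of_nonneg h₂).2 fun i =>
    (pi_norm_le_iff_of_nonneg h₂).2 fun l => (pi_norm_le_iff_of_nonneg h₂).2
    fun a => hR₂ ⟨i, l, a⟩ t ht)

lemma continuousOn_partialDeriv_boundedRegion (hΦ : Φ.Admissible G) (hfun : D.FunnelsOK Φ G) (R : ℝ)
    (i l : V) (a : Fin (n l)) :
    ContinuousOn (fun y : State n × (V → State n) => partialDeriv (Φ.rho i) l a (y.2 i))
      (boundedRegion Φ D R) := fun y hy =>
  (ContinuousAt.comp (f := fun y : State n × (V → State n) => y.2 i)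
    ((hΦ.robustness i).continuousAt_partialDeriv (hfun.not_isMaxOn (hy.2 i)) l a)
    (by fun_prop)).continuousWithinAt

open Classical in
/-- The vector `∑_j z_j ∂ρ_j/∂x_l`, the sum over the cluster of `l`, with `∂ρ_j` evaluated at `y j`. -/
noncomputable def clusterGradient (Φ : Spec n) (G : SimpleGraph V) (y : V → State n) (z : V → ℝ)
    (l : V) : Fin (n l) → ℝ :=
  fun a => ∑ j with Φ.clusterOf G j = Φ.clusterOf G l, partialDeriv (Φ.rho j) l a (y j) * z j

/-- If no task has a zero gradient in the state of its agent, then the weights of a vanishing cluster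
gradient vanish, by acyclicity of the task graph. -/
lemma eq_zero_of_clusterGradient_eq_zero (hΦ : Φ.Admissible G) {y : V → State n}
    (hy : ∀ i, ¬ IsMaxOn (Φ.rho i) univ (y i)) {z : V → ℝ}
    (hz : ∀ l a, clusterGradient Φ G y z l a = 0) : z = 0 := by
  classical
  funext i
  induction i using hΦ.acyclic.wellFounded.induction with
  | _ i ih =>
  by_contra hne
  refine hy i ((hΦ.robustness i).gradient _ fun a => ?_)
  have h := hz i a
  -- In the component of `x_i` only the term of `i` survives: an agent `j ≠ i` whose task depends on
  -- `x_i` has zero weight by induction, and all others have zero derivative.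
  rw [clusterGradient, Finset.sum_eq_single i] at h
  · exact (mul_eq_zero.1 h).resolve_right hne
  · intro j _ hj
    by_cases he : Φ.TaskEdge j i
    · rw [ih j ⟨hj, he⟩, Pi.zero_apply, mul_zero]
    · rw [Spec.partialDeriv_eq_zero he, zero_mul]
  · intro hi
    exact absurd (by simp) hi

/-- The power `∑_l ‖g_lᵀ v_l‖²` of the feedback law, where `v_l` are the cluster gradients. -/
noncomputable def feedbackPower (A : Agents n m) (Φ : Spec n) (G : SimpleGraph V)
    (y : State n × (V → State n)) (z : V → ℝ) : ℝ :=
  ∑ l, ∑ b, (∑ a, A.g l (y.1 l) a b * clusterGradient Φ G y.2 z l a) ^ 2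

/-- The power is quadratic in `z` and continuous on the compact region. If it is zero, each `g_lᵀ
v_l` vanishes, hence each `v_l` since `g_l g_lᵀ` is positive definite, and then `z = 0` by
acyclicity. -/
lemma exists_feedbackPower_lower_bound (hA : A.Regular) (hΦ : Φ.Admissible G)
    (hfun : D.FunnelsOK Φ G) (R : ℝ) :
    ∃ c > 0, ∀ y ∈ boundedRegion Φ D R, ∀ z, c * ∑ j, z j ^ 2 ≤ feedbackPower A Φ G y z := by
  classical
  refine exists_quadratic_lower_bound (isCompact_boundedRegion hΦ R) ?_ (fun y c z => ?_)
    fun y hy z hz => ?_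
  · unfold feedbackPower clusterGradient
    refine continuousOn_finsetSum _ fun l _ => continuousOn_finsetSum _ fun b _ =>
      (continuousOn_finsetSum _ fun a _ => ContinuousOn.mul ?_
        (continuousOn_finsetSum _ fun j _ => ContinuousOn.mul ?_ (by fun_prop))).pow 2
    · exact ((hA.g_lipschitz l a b).continuous.comp (by fun_prop : Continuous
        fun p : (State n × (V → State n)) × (V → ℝ) => p.1.1 l)).continuousOn
    · exact (continuousOn_partialDeriv_boundedRegion hΦ hfun R j l a).comp continuousOn_fst
        fun p hp => hp.1
  · have h1 : ∀ l a, clusterGradient Φ G y.2 (c • z) l a = c * clusterGradient Φ G y.2 z l a :=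
      fun l a => by
        simp only [clusterGradient, Pi.smul_apply, smul_eq_mul, Finset.mul_sum]
        exact Finset.sum_congr rfl fun j _ => by ring
    simp only [feedbackPower, h1, Finset.mul_sum]
    refine Finset.sum_congr rfl fun l _ => Finset.sum_congr rfl fun b _ => ?_
    rw [← mul_pow, Finset.mul_sum]
    exact congrArg (· ^ 2) (Finset.sum_congr rfl fun a _ => by ring)
  · have h0 : ∀ l b, 0 ≤ (∑ a, A.g l (y.1 l) a b * clusterGradient Φ G y.2 z l a) ^ 2 :=
      fun l b => sq_nonneg _
    have h0' := fun l => Finset.sum_nonneg fun b (_ : b ∈ Finset.univ) => h0 l b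
    refine lt_of_le_of_ne (Finset.sum_nonneg fun l _ => h0' l) fun h => hz ?_
    refine eq_zero_of_clusterGradient_eq_zero hΦ (fun i => hfun.not_isMaxOn (hy.2 i)) fun l => ?_
    have h1 : ∀ b, ∑ a, A.g l (y.1 l) a b * clusterGradient Φ G y.2 z l a = 0 := fun b => by
      have h2 := (Finset.sum_eq_zero_iff_of_nonneg fun l _ => h0' l).1 h.symm l (Finset.mem_univ l)
      have h3 := (Finset.sum_eq_zero_iff_of_nonneg fun b _ => h0 l b).1 h2 b (Finset.mem_univ b)
      exact pow_eq_zero_iff two_ne_zero |>.1 h3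
    have h2 : (A.g l (y.1 l)).transpose *ᵥ clusterGradient Φ G y.2 z l = 0 := funext h1
    by_contra hne
    have hne' : clusterGradient Φ G y.2 z l ≠ 0 := fun h => hne fun a => congrFun h a
    have h3 := (hA.g_posDef l (y.1 l)).dotProduct_mulVec_pos hne'
    rw [← mulVec_mulVec, h2, mulVec_zero, dotProduct_zero] at h3
    exact lt_irrefl _ h3

end APriori

/-! ### Dissipation estimates for controllers and observers -/

section Velocities

open Filter Topology Matrix

set_option linter.unusedSectionVars false

variable {V : Type*} [Fintype V] [DecidableEq V] {n m : V → ℕ}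
  {A : Agents n m} {Φ : Spec n} {G : SimpleGraph V} {D : Design n}
  {I : Set ℝ} {x : ℝ → State n} {xhat : ℝ → Estimates n}

/-- The weight `Γ_j⁻¹ J_j ε_j` of the task of `j` in the feedback law. -/
noncomputable def taskWeight (Φ : Spec n) (G : SimpleGraph V) (D : Design n) (t : ℝ) (x : State n)
    (xhat : Estimates n) (j : V) : ℝ :=
  (D.Γ j t)⁻¹ * taskJac (normError Φ G D t x xhat j) * taskTrans (normError Φ G D t x xhat j)

lemma controlInput_eq (t : ℝ) (x : State n) (xhat : Estimates n) (i : V) :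
    controlInput A Φ G D t x xhat i = -((A.g i (x i)).transpose *ᵥ
      clusterGradient Φ G (taskState Φ G x xhat) (taskWeight Φ G D t x xhat) i) := by
  unfold controlInput clusterGradient taskWeight
  congr 3
  funext a
  exact Finset.sum_congr rfl fun j _ => by ring

lemma agentRate_apply (t : ℝ) (x : State n) (xhat : Estimates n) (i : V) (a : Fin (n i)) :
    agentRate A Φ G D t x xhat i a = A.f i (x i) a + A.w i x t a -
      (A.g i (x i) *ᵥ (A.g i (x i)).transpose *ᵥ
        clusterGradient Φ G (taskState Φ G x xhat) (taskWeight Φ G D t x xhat) i) a := by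
  rw [agentRate, controlInput_eq, mulVec_neg]
  simp only [Pi.add_apply, Pi.neg_apply]
  ring

open Classical in
/-- The power that the feedback law dissipates within a cluster. -/
lemma sum_weight_mul_eq_feedbackPower (x : State n) (y : V → State n) (z : V → ℝ) (C : Φ.Cluster G) :
    ∑ j with Φ.clusterOf G j = C, z j * ∑ l with Φ.clusterOf G l = C, ∑ a,
        partialDeriv (Φ.rho j) l a (y j) *
          (A.g l (x l) *ᵥ (A.g l (x l)).transpose *ᵥ clusterGradient Φ G y z l) a =
      feedbackPower A Φ G (x, y) fun j => if Φ.clusterOf G j = C then z j else 0 := by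
  -- Truncating the weights to the cluster `C` keeps the cluster gradients inside `C` and removes
  -- those outside, so the global coercivity estimate can be used for one cluster.
  have hgrad : ∀ l, clusterGradient Φ G y (fun j => if Φ.clusterOf G j = C then z j else 0) l =
      if Φ.clusterOf G l = C then clusterGradient Φ G y z l else 0 := fun l => by
    funext a
    split_ifs with hl
    · refine Finset.sum_congr rfl fun j hj => ?_
      beta_reduce
      rw [if_pos ((Finset.mem_filter.1 hj).2.trans hl)]
    · refine Finset.sum_eq_zero fun j hj => ?_
      beta_reduce
      rw [if_neg fun h => hl ((Finset.mem_filter.1 hj).2.symm.trans h), mul_zero]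
  have hquad : ∀ l, ∑ b, (∑ a, A.g l (x l) a b * clusterGradient Φ G y z l a) ^ 2 =
      ∑ a, clusterGradient Φ G y z l a *
        (A.g l (x l) *ᵥ (A.g l (x l)).transpose *ᵥ clusterGradient Φ G y z l) a := fun l => by
    have h1 := dotProduct_mulVec (clusterGradient Φ G y z l) (A.g l (x l))
      ((A.g l (x l)).transpose *ᵥ clusterGradient Φ G y z l)
    rw [← mulVec_transpose] at h1
    refine Eq.trans ?_ h1.symm
    exact Finset.sum_congr rfl fun b _ => sq _
  have hpow : feedbackPower A Φ G (x, y) (fun j => if Φ.clusterOf G j = C then z j else 0) =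
      ∑ l with Φ.clusterOf G l = C, ∑ a, clusterGradient Φ G y z l a *
        (A.g l (x l) *ᵥ (A.g l (x l)).transpose *ᵥ clusterGradient Φ G y z l) a := by
    rw [feedbackPower, Finset.sum_filter]
    refine Finset.sum_congr rfl fun l _ => ?_
    simp only [hgrad l]
    split_ifs with hl
    · exact hquad l
    · simp
  rw [hpow]
  simp only [Finset.mul_sum]
  rw [Finset.sum_comm]
  refine Finset.sum_congr rfl fun l hl => ?_
  rw [Finset.sum_comm]
  refine Finset.sum_congr rfl fun a _ => ?_
  rw [clusterGradient, (Finset.mem_filter.1 hl).2, Finset.sum_mul]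
  exact Finset.sum_congr rfl fun j _ => by ring

open Classical in
/-- Velocity of the vector on which agent `j` evaluates its robustness. -/
noncomputable def taskVelocity (A : Agents n m) (Φ : Spec n) (G : SimpleGraph V) (D : Design n) (t : ℝ)
    (x : State n) (xhat : Estimates n) (j : V) : State n :=
  fun l a => if l ∈ Φ.estimated G j then observerRate G D t x xhat l j a
    else agentRate A Φ G D t x xhat l a

lemma IsSolution.hasDerivWithinAt_rho (hG : G.Connected) (hΦ : Φ.Admissible G)
    (hobs : D.ObserverOK Φ G) (hfun : D.FunnelsOK Φ G) (h : IsSolution A Φ G D I x xhat)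
    {t : ℝ} (ht : t ∈ I) (hin : InFunnels Φ G D t (x t) (xhat t)) (j : V) :
    HasDerivWithinAt (fun s => Φ.rho j (taskState Φ G (x s) (xhat s) j) - D.ρmax j)
      (∑ l, ∑ a, partialDeriv (Φ.rho j) l a (taskState Φ G (x t) (xhat t) j) *
        taskVelocity A Φ G D t (x t) (xhat t) j l a) (Ici 0) t := by
  have h1 : HasDerivWithinAt (fun s => taskState Φ G (x s) (xhat s) j)
      (taskVelocity A Φ G D t (x t) (xhat t) j) (Ici 0) t := by
    refine hasDerivWithinAt_pi.2 fun l => hasDerivWithinAt_pi.2 fun a => ?_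
    by_cases hl : l ∈ Φ.estimated G j
    · simp only [taskState, taskVelocity, if_pos hl]
      exact h.observers t ht l j (mem_kHop_of_estimated hG hobs hl) a
    · simp only [taskState, taskVelocity, if_neg hl]
      exact hasDerivWithinAt_pi.1 (h.agents t ht l) a
  have hd := ((hΦ.robustness j).smooth _
    (hfun.not_isMaxOn (sub_neg.1 (hin.task j).2).le)).differentiableAt one_ne_zero
  rw [← fderiv_apply_eq_sum_partialDeriv]
  exact (hd.hasFDerivAt.comp_hasDerivWithinAt t h1).sub_const _

lemma absBoundedOn_partialDeriv (hΦ : Φ.Admissible G) (hfun : D.FunnelsOK Φ G) {R : ℝ}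
    (hR : ∀ t ∈ I, (x t, taskState Φ G (x t) (xhat t)) ∈ boundedRegion Φ D R) (j l : V)
    (a : Fin (n l)) :
    AbsBoundedOn I fun t => partialDeriv (Φ.rho j) l a (taskState Φ G (x t) (xhat t) j) :=
  AbsBoundedOn.comp_compact (isCompact_boundedRegion hΦ R)
    (continuousOn_partialDeriv_boundedRegion hΦ hfun R j l a) hR

lemma absBoundedOn_f (hA : A.Regular) (hΦ : Φ.Admissible G) {R : ℝ}
    (hR : ∀ t ∈ I, (x t, taskState Φ G (x t) (xhat t)) ∈ boundedRegion Φ D R) (l : V)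
    (a : Fin (n l)) : AbsBoundedOn I fun t => A.f l (x t l) a :=
  AbsBoundedOn.comp_compact (F := fun y : State n × (V → State n) => A.f l (y.1 l) a)
    (isCompact_boundedRegion hΦ R)
    (((continuous_apply a).comp ((hA.f_lipschitz l).continuous.comp (by fun_prop :
      Continuous fun y : State n × (V → State n) => y.1 l))).continuousOn) hR

lemma absBoundedOn_g (hA : A.Regular) (hΦ : Φ.Admissible G) {R : ℝ}
    (hR : ∀ t ∈ I, (x t, taskState Φ G (x t) (xhat t)) ∈ boundedRegion Φ D R) (l : V)
    (a : Fin (n l)) (b : Fin (m l)) : AbsBoundedOn I fun t => A.g l (x t l) a b :=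
  AbsBoundedOn.comp_compact (F := fun y : State n × (V → State n) => A.g l (y.1 l) a b)
    (isCompact_boundedRegion hΦ R)
    (((hA.g_lipschitz l a b).continuous.comp (by fun_prop :
      Continuous fun y : State n × (V → State n) => y.1 l)).continuousOn) hR

lemma absBoundedOn_w (hA : A.Regular) (hI : I ⊆ Ici 0) (l : V) (a : Fin (n l)) :
    AbsBoundedOn I fun t => A.w l (x t) t a := by
  obtain ⟨B, hB⟩ := hA.w_bounded l
  exact ⟨B, fun t ht => hB _ t (hI ht) a⟩

/-- The transformed errors of a cluster stay bounded if the estimates that its tasks use have bounded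
velocity. -/
lemma absBoundedOn_taskTrans (hG : G.Connected) (hA : A.Regular) (hΦ : Φ.Admissible G)
    (hobs : D.ObserverOK Φ G) (hfun : D.FunnelsOK Φ G) {T : ℝ}
    (h : IsSolution A Φ G D (Ico 0 T) x xhat)
    (hin : ∀ t ∈ Ico 0 T, InFunnels Φ G D t (x t) (xhat t)) (C : Φ.Cluster G)
    (hvel : ∀ j, Φ.clusterOf G j = C → ∀ l ∈ Φ.estimated G j, ∀ a,
      AbsBoundedOn (Ico 0 T) fun t => observerRate G D t (x t) (xhat t) l j a)
    (i : V) (hi : Φ.clusterOf G i = C) :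
    AbsBoundedOn (Ico 0 T) fun t => taskTrans (normError Φ G D t (x t) (xhat t) i) := by
  classical
  have hI : Ico 0 T ⊆ Ici 0 := Ico_subset_Ici_self
  obtain ⟨R, hR⟩ := exists_mem_boundedRegion hG hΦ hobs hfun hI hin
  obtain ⟨c, hc, hpow⟩ := exists_feedbackPower_lower_bound (D := D) hA hΦ hfun R
  choose Γ' hΓ using fun i => hfun.exists_deriv_Γ i
  choose BΓ hΓ using hΓ
  -- the part of the derivative of the robustness that is not due to the feedback
  let b : V → ℝ → ℝ := fun j t => ∑ l, ∑ a,
    partialDeriv (Φ.rho j) l a (taskState Φ G (x t) (xhat t) j) *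
      if Φ.clusterOf G l = C then A.f l (x t l) a + A.w l (x t) t a
        else taskVelocity A Φ G D t (x t) (xhat t) j l a
  have hb : ∀ j : {j // Φ.clusterOf G j = C}, AbsBoundedOn (Ico 0 T) (b j) := by
    rintro ⟨j, hj⟩
    refine AbsBoundedOn.sum fun l _ => AbsBoundedOn.sum fun a _ => ?_
    by_cases hl : Φ.clusterOf G l = C
    · simp only [if_pos hl]
      exact (absBoundedOn_partialDeriv hΦ hfun hR j l a).mul
        ((absBoundedOn_f hA hΦ hR l a).add (absBoundedOn_w hA hI l a))
    · simp only [if_neg hl]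
      -- A state outside the cluster enters through an estimate, whose velocity is bounded by
      -- `hvel`, or not at all.
      by_cases he : Φ.TaskEdge j l
      · have hmem := Spec.mem_estimated_of_taskEdge (G := G) (by rw [hj]; exact hl) he
        simp only [taskVelocity, if_pos hmem]
        exact (absBoundedOn_partialDeriv hΦ hfun hR j l a).mul (hvel j hj l hmem a)
      · simp only [Spec.partialDeriv_eq_zero he, zero_mul]
        exact absBoundedOn_const 0
  obtain ⟨B₁, hB₁, hbB⟩ := exists_uniform_absBound hb
  obtain ⟨B₂, hB₂⟩ := Finite.exists_le BΓ
  have hdecomp : ∀ t ∈ Ico 0 T, ∀ j, Φ.clusterOf G j = C →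
      ∑ l, ∑ a, partialDeriv (Φ.rho j) l a (taskState Φ G (x t) (xhat t) j) *
        taskVelocity A Φ G D t (x t) (xhat t) j l a = b j t -
      ∑ l with Φ.clusterOf G l = C, ∑ a,
        partialDeriv (Φ.rho j) l a (taskState Φ G (x t) (xhat t) j) *
          (A.g l (x t l) *ᵥ (A.g l (x t l)).transpose *ᵥ clusterGradient Φ G
            (taskState Φ G (x t) (xhat t)) (taskWeight Φ G D t (x t) (xhat t)) l) a := by
    intro t ht j hj
    rw [Finset.sum_filter, ← Finset.sum_sub_distrib]
    refine Finset.sum_congr rfl fun l _ => ?_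
    split_ifs with hl
    · rw [← Finset.sum_sub_distrib]
      refine Finset.sum_congr rfl fun a _ => ?_
      rw [taskVelocity, if_neg (hΦ.not_mem_estimated (hl.trans hj.symm)), agentRate_apply]
      ring
    · rw [sub_zero]
  have key := exists_bound_transformed_error (Finset.univ.filter fun j => Φ.clusterOf G j = C)
    (T := T) (τ := taskTrans) (J := taskJac) (S := Ioo (-1 : ℝ) 0)
    (fun e he => abs_le.2 ⟨he.1.le, by linarith [he.2]⟩) (fun e he => hasDerivAt_taskTrans he)
    (r := fun j t => D.Γ j t) (r' := Γ')
    (y := fun j t => Φ.rho j (taskState Φ G (x t) (xhat t) j) - D.ρmax j)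
    (fun j _ t ht => hfun.Γ_pos j t ht.1) (fun j _ t ht => (hΓ j t ht.1).1)
    (fun j _ t ht => h.hasDerivWithinAt_rho hG hΦ hobs hfun ht (hin t ht) j)
    (fun j _ t ht => (normError_mem_Ioo_iff (hfun.Γ_pos j t ht.1)).2 ((hin t ht).task j))
    hc (B := max B₁ B₂)
    (fun j _ t ht => ((hΓ j t ht.1).2.trans (hB₂ j)).trans (le_max_right _ _)) ?_
  · obtain ⟨K, hK⟩ := key
    exact ⟨K, fun t ht => hK t ht i (by simpa using hi)⟩
  -- The weighted derivative is `∑ z_j b_j` minus the feedback power of the cluster. The first is at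
  -- most `B ∑ |z_j|`, the second at least `c ∑ z_j²`.
  intro t ht
  change ∑ j with Φ.clusterOf G j = C, taskWeight Φ G D t (x t) (xhat t) j * _ ≤
    -c * ∑ j with Φ.clusterOf G j = C, taskWeight Φ G D t (x t) (xhat t) j ^ 2 +
      max B₁ B₂ * ∑ j with Φ.clusterOf G j = C, |taskWeight Φ G D t (x t) (xhat t) j|
  set z := taskWeight Φ G D t (x t) (xhat t)
  have h1 := sum_weight_mul_eq_feedbackPower (A := A) (x t) (taskState Φ G (x t) (xhat t)) z C
  have h2 := hpow _ (hR t ht) fun j => if Φ.clusterOf G j = C then z j else 0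
  have h3 : ∑ j, (if Φ.clusterOf G j = C then z j else 0) ^ 2 =
      ∑ j with Φ.clusterOf G j = C, z j ^ 2 := by
    rw [Finset.sum_filter]
    exact Finset.sum_congr rfl fun j _ => by split_ifs <;> simp
  rw [h3, ← h1] at h2
  have h4 : ∑ j with Φ.clusterOf G j = C, z j * b j t ≤
      max B₁ B₂ * ∑ j with Φ.clusterOf G j = C, |z j| := by
    rw [Finset.mul_sum]
    refine Finset.sum_le_sum fun j hj => ?_
    have h5 := hbB ⟨j, (Finset.mem_filter.1 hj).2⟩ t ht
    calc z j * b j t ≤ |z j| * |b j t| := by rw [← abs_mul]; exact le_abs_self _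
      _ ≤ |z j| * max B₁ B₂ := by gcongr; exact h5.trans (le_max_left _ _)
      _ = _ := mul_comm _ _
  rw [Finset.sum_congr rfl fun j hj => by
    rw [hdecomp t ht j (Finset.mem_filter.1 hj).2, mul_sub], Finset.sum_sub_distrib]
  linarith

/-- Disagreements are linear in states and estimates, so their derivatives are the disagreements of
the velocities. -/
lemma hasDerivWithinAt_disagreement (h : IsSolution A Φ G D I x xhat) {t : ℝ} (ht : t ∈ I) {i j : V}
    (hj : j ∈ kHop G D.k i) (a : Fin (n i)) :
    HasDerivWithinAt (fun s => disagreement G D.k (x s) (xhat s) i j a)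
      (disagreement G D.k (fun l => agentRate A Φ G D t (x t) (xhat t) l)
        (fun l k => observerRate G D t (x t) (xhat t) k l) i j a) (Ici 0) t := by
  classical
  have hx := hasDerivWithinAt_pi.1 (h.agents t ht i) a
  unfold disagreement
  refine HasDerivWithinAt.fun_add (HasDerivWithinAt.fun_sum fun l hl => ?_) ?_
  · rw [Finset.mem_filter] at hl
    exact (h.observers t ht i j hj a).fun_sub (h.observers t ht i l hl.2.2 a)
  · exact ((h.observers t ht i j hj a).fun_sub hx).const_mul _

/-- The transformed disagreements on the state of an agent stay bounded if its velocity is bounded. -/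
lemma absBoundedOn_obsTrans (hG : G.Connected) (hobs : D.ObserverOK Φ G) {T : ℝ}
    (h : IsSolution A Φ G D (Ico 0 T) x xhat)
    (hin : ∀ t ∈ Ico 0 T, InFunnels Φ G D t (x t) (xhat t)) {i : V} {a : Fin (n i)}
    (hvel : AbsBoundedOn (Ico 0 T) fun t => agentRate A Φ G D t (x t) (xhat t) i a)
    {j : V} (hj : j ∈ kHop G D.k i) :
    AbsBoundedOn (Ico 0 T) fun t => obsTrans (normDisagreement G D t (x t) (xhat t) i j a) := by
  classical
  obtain ⟨c, hc, hquad⟩ := exists_quadratic_lower_bound (isCompact_singleton (x := ()))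
    (Q := fun (_ : Unit) (z : kHop G D.k i → ℝ) => z ⬝ᵥ (obsMatrix G D.k i *ᵥ z))
    (by
      simp only [dotProduct, mulVec]
      fun_prop)
    (fun _ c z => by
      rw [mulVec_smul, dotProduct_smul, smul_dotProduct]
      simp only [smul_eq_mul]
      ring)
    fun _ _ z hz => obsMatrix_quadratic_pos hG D.k i hz
  have hdρ : ∀ r : kHop G D.k i, ∃ B, ∀ t, 0 ≤ t →
      |derivWithin (D.obsFunnel i r a) (Ici 0) t| ≤ B :=
    fun r => (hobs.obsFunnel_ppf i r r.2 a).deriv_bounded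
  choose Bρ hBρ using hdρ
  obtain ⟨B₂, hB₂⟩ := Finite.exists_le Bρ
  -- the part of the derivative of the disagreements that is due to the motion of agent `i`
  have hb : ∀ r : kHop G D.k i, AbsBoundedOn (Ico 0 T) fun t =>
      (obsMatrix G D.k i *ᵥ fun _ => agentRate A Φ G D t (x t) (xhat t) i a) r := fun r => by
    simp only [mulVec, dotProduct]
    exact AbsBoundedOn.sum fun q _ => (absBoundedOn_const _).mul hvel
  obtain ⟨B₁, hB₁, hbB⟩ := exists_uniform_absBound hb
  have key := exists_bound_transformed_error (Finset.univ : Finset (kHop G D.k i))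
    (T := T) (τ := obsTrans) (J := obsJac) (S := Ioo (-1 : ℝ) 1)
    (fun e he => abs_le.2 ⟨he.1.le, he.2.le⟩) (fun e he => hasDerivAt_obsTrans he)
    (r := fun r t => D.obsFunnel i r a t)
    (r' := fun r t => derivWithin (D.obsFunnel i r a) (Ici 0) t)
    (y := fun r t => disagreement G D.k (x t) (xhat t) i r a)
    (fun r _ t ht => (hobs.obsFunnel_ppf i r r.2 a).pos t ht.1)
    (fun r _ t ht => (hobs.obsFunnel_ppf i r r.2 a).hasDerivWithinAt ht.1)
    (fun r _ t ht => hasDerivWithinAt_disagreement h ht r.2 a)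
    (fun r _ t ht => (normDisagreement_mem_Ioo_iff
      ((hobs.obsFunnel_ppf i r r.2 a).pos t ht.1)).2 ((hin t ht).observer i r r.2 a))
    hc (B := max B₁ B₂)
    (fun r _ t ht => ((hBρ r t ht.1).trans (hB₂ r)).trans (le_max_right _ _)) ?_
  · obtain ⟨K, hK⟩ := key
    exact ⟨K, fun t ht => hK t ht ⟨j, hj⟩ (Finset.mem_univ _)⟩
  intro t ht
  set z : kHop G D.k i → ℝ := fun r => (D.obsFunnel i r a t)⁻¹ *
    obsJac (normDisagreement G D t (x t) (xhat t) i r a) *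
    obsTrans (normDisagreement G D t (x t) (xhat t) i r a) with hz
  set v := agentRate A Φ G D t (x t) (xhat t) i a with hv
  change ∑ r, z r * _ ≤ -c * ∑ r, z r ^ 2 + max B₁ B₂ * ∑ r, |z r|
  -- The observers move with velocity `-z` and agent `i` with velocity `v`, so the error velocity is
  -- `-z - v` and the disagreements change at rate `-M z - M (v, …, v)`. The first term dissipates
  -- and the second is bounded.
  have h1 : ∀ r : kHop G D.k i, disagreement G D.k (fun l => agentRate A Φ G D t (x t) (xhat t) l)
      (fun l k => observerRate G D t (x t) (xhat t) k l) i r a =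
      -(obsMatrix G D.k i *ᵥ z) r - (obsMatrix G D.k i *ᵥ fun _ => v) r := fun r => by
    rw [disagreement_eq_mulVec, ← Pi.neg_apply, ← mulVec_neg, ← Pi.sub_apply, ← mulVec_sub]
    rfl
  have h2 : c * ∑ r, z r ^ 2 ≤ ∑ r, z r * (obsMatrix G D.k i *ᵥ z) r := hquad () rfl z
  have h3 : -∑ r, z r * (obsMatrix G D.k i *ᵥ fun _ => v) r ≤ max B₁ B₂ * ∑ r, |z r| := by
    rw [Finset.mul_sum, ← Finset.sum_neg_distrib]
    refine Finset.sum_le_sum fun r _ => ?_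
    calc -(z r * (obsMatrix G D.k i *ᵥ fun _ => v) r)
        ≤ |z r| * |(obsMatrix G D.k i *ᵥ fun _ => v) r| := by rw [← abs_mul]; exact neg_le_abs _
      _ ≤ |z r| * max B₁ B₂ := by gcongr; exact (hbB r t ht).trans (le_max_left _ _)
      _ = _ := mul_comm _ _
  rw [Finset.sum_congr rfl fun r _ => by rw [h1 r, mul_sub, mul_neg], Finset.sum_sub_distrib,
    Finset.sum_neg_distrib]
  linarith

end Velocities

/-! ### Induction over clusters and confinement to the funnels -/

section Trapping

open Filter Topology Matrix

set_option linter.unusedSectionVars false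

variable {V : Type*} [Fintype V] [DecidableEq V] {n m : V → ℕ}
  {A : Agents n m} {Φ : Spec n} {G : SimpleGraph V} {D : Design n}
  {I : Set ℝ} {x : ℝ → State n} {xhat : ℝ → Estimates n}

/-- A bounded transformed error confines the normalized error to a compact subinterval of `(-1, 0)`,
on which the blowing-up factor `taskJac` is bounded too. -/
lemma absBoundedOn_taskWeight (hfun : D.FunnelsOK Φ G) {T : ℝ}
    (hin : ∀ t ∈ Ico 0 T, InFunnels Φ G D t (x t) (xhat t)) {j : V}
    (h : AbsBoundedOn (Ico 0 T) fun t => taskTrans (normError Φ G D t (x t) (xhat t) j)) :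
    AbsBoundedOn (Ico 0 T) fun t => taskWeight Φ G D t (x t) (xhat t) j := by
  obtain ⟨K, hK⟩ := h
  obtain ⟨lo, hi, hlo, hhi, hmem⟩ := exists_Icc_of_abs_taskTrans_le K
  have hsub : Icc lo hi ⊆ Ioo (-1 : ℝ) 0 := fun e he => ⟨hlo.trans_le he.1, he.2.trans_lt hhi⟩
  have h1 : AbsBoundedOn (Ico 0 T) fun t => taskJac (normError Φ G D t (x t) (xhat t) j) *
      taskTrans (normError Φ G D t (x t) (xhat t) j) :=
    AbsBoundedOn.comp_compact (F := fun e => taskJac e * taskTrans e) isCompact_Icc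
      (fun e he => ((continuousAt_taskJac (hsub he)).mul
        (hasDerivAt_taskTrans (hsub he)).continuousAt).continuousWithinAt)
      fun t ht => hmem _ ((normError_mem_Ioo_iff (hfun.Γ_pos j t ht.1)).2 ((hin t ht).task j))
        (hK t ht)
  exact ((absBoundedOn_inv (hfun.continuousOn_Γ j) (hfun.Γ_pos j)).mul h1).congr
    fun t _ => by rw [taskWeight, mul_assoc]

lemma absBoundedOn_agentRate (hG : G.Connected) (hA : A.Regular) (hΦ : Φ.Admissible G)
    (hobs : D.ObserverOK Φ G) (hfun : D.FunnelsOK Φ G) {T : ℝ}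
    (hin : ∀ t ∈ Ico 0 T, InFunnels Φ G D t (x t) (xhat t)) {i : V}
    (h : ∀ j, Φ.clusterOf G j = Φ.clusterOf G i →
      AbsBoundedOn (Ico 0 T) fun t => taskTrans (normError Φ G D t (x t) (xhat t) j))
    (a : Fin (n i)) :
    AbsBoundedOn (Ico 0 T) fun t => agentRate A Φ G D t (x t) (xhat t) i a := by
  classical
  have hI : Ico 0 T ⊆ Ici 0 := Ico_subset_Ici_self
  obtain ⟨R, hR⟩ := exists_mem_boundedRegion hG hΦ hobs hfun hI hin
  simp only [agentRate_apply, sub_eq_add_neg]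
  refine ((absBoundedOn_f hA hΦ hR i a).add (absBoundedOn_w hA hI i a)).add (AbsBoundedOn.neg ?_)
  simp only [mulVec, dotProduct, transpose_apply, clusterGradient]
  refine AbsBoundedOn.sum fun b _ => (absBoundedOn_g hA hΦ hR i a b).mul ?_
  refine AbsBoundedOn.sum fun c _ => (absBoundedOn_g hA hΦ hR i c b).mul ?_
  refine AbsBoundedOn.sum fun j hj => (absBoundedOn_partialDeriv hΦ hfun hR j i c).mul ?_
  exact absBoundedOn_taskWeight hfun hin (h j (Finset.mem_filter.1 hj).2)

lemma absBoundedOn_observerRate (hobs : D.ObserverOK Φ G) {T : ℝ}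
    (hin : ∀ t ∈ Ico 0 T, InFunnels Φ G D t (x t) (xhat t)) {i j : V} {a : Fin (n i)}
    (hj : j ∈ kHop G D.k i)
    (h : AbsBoundedOn (Ico 0 T) fun t =>
      obsTrans (normDisagreement G D t (x t) (xhat t) i j a)) :
    AbsBoundedOn (Ico 0 T) fun t => observerRate G D t (x t) (xhat t) i j a := by
  obtain ⟨K, hK⟩ := h
  obtain ⟨lo, hi, hlo, hhi, hmem⟩ := exists_Icc_of_abs_obsTrans_le K
  have hsub : Icc lo hi ⊆ Ioo (-1 : ℝ) 1 := fun e he => ⟨hlo.trans_le he.1, he.2.trans_lt hhi⟩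
  have hρ := hobs.obsFunnel_ppf i j hj a
  have h1 : AbsBoundedOn (Ico 0 T) fun t => obsJac (normDisagreement G D t (x t) (xhat t) i j a) *
      obsTrans (normDisagreement G D t (x t) (xhat t) i j a) :=
    AbsBoundedOn.comp_compact (F := fun e => obsJac e * obsTrans e) isCompact_Icc
      (fun e he => ((continuousAt_obsJac (hsub he)).mul
        (hasDerivAt_obsTrans (hsub he)).continuousAt).continuousWithinAt)
      fun t ht => hmem _ ((normDisagreement_mem_Ioo_iff (hρ.pos t ht.1)).2
        ((hin t ht).observer i j hj a)) (hK t ht)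
  exact ((absBoundedOn_inv hρ.contDiff.continuousOn hρ.pos).mul h1).neg.congr
    fun t _ => by rw [observerRate, mul_assoc]

/-- Velocities and transformed errors stay bounded, by induction along the cluster-induced graph. -/
lemma absBoundedOn_transformed_errors (hG : G.Connected) (hA : A.Regular) (hΦ : Φ.Admissible G)
    (hobs : D.ObserverOK Φ G) (hfun : D.FunnelsOK Φ G) {T : ℝ}
    (h : IsSolution A Φ G D (Ico 0 T) x xhat)
    (hin : ∀ t ∈ Ico 0 T, InFunnels Φ G D t (x t) (xhat t)) (i : V) :
    (AbsBoundedOn (Ico 0 T) fun t => taskTrans (normError Φ G D t (x t) (xhat t) i)) ∧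
    ∀ a, (AbsBoundedOn (Ico 0 T) fun t => agentRate A Φ G D t (x t) (xhat t) i a) ∧
      ∀ j ∈ kHop G D.k i,
        (AbsBoundedOn (Ico 0 T) fun t => obsTrans (normDisagreement G D t (x t) (xhat t) i j a)) ∧
        AbsBoundedOn (Ico 0 T) fun t => observerRate G D t (x t) (xhat t) i j a := by
  obtain ⟨C, hC⟩ : ∃ C, Φ.clusterOf G i = C := ⟨_, rfl⟩
  induction C using hΦ.cluster_acyclic.wellFounded_swap.induction generalizing i with
  | _ C ih =>
  -- Each estimated agent lies in another cluster, the target of an edge from `C`, so the velocity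
  -- of its estimates is bounded by the induction hypothesis.
  have htask := absBoundedOn_taskTrans hG hA hΦ hobs hfun h hin C fun j hj l hl a => by
    have hne : Φ.clusterOf G l ≠ Φ.clusterOf G j := fun he => hΦ.not_mem_estimated he hl
    have hedge : Φ.ClusterEdge G C (Φ.clusterOf G l) :=
      ⟨fun he => hne (he.symm.trans hj.symm), j, l, hj, rfl, hl.1.resolve_right hl.2.1⟩
    exact (((ih _ hedge l rfl).2 a).2 j (mem_kHop_of_estimated hG hobs hl)).2
  refine ⟨htask i hC, fun a => ?_⟩
  have hrate := absBoundedOn_agentRate hG hA hΦ hobs hfun hin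
    (fun j hj => htask j (hj.trans hC)) a
  refine ⟨hrate, fun j hj => ?_⟩
  have hobsT := absBoundedOn_obsTrans hG hobs h hin hrate hj
  exact ⟨hobsT, absBoundedOn_observerRate hobs hin hj hobsT⟩

/-- Solutions in the funnels have bounded velocity on bounded time intervals, and stay away from the
boundaries of the funnels. -/
theorem closedLoop_trapped (hG : G.Connected) (hA : A.Regular) (hΦ : Φ.Admissible G)
    (hobs : D.ObserverOK Φ G) (hfun : D.FunnelsOK Φ G) {T : ℝ} (hT : 0 < T)
    {p : ℝ → State n × Estimates n} (hp : SolvesOn (closedLoop A Φ G D) (Ico 0 T) p)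
    (hmem : ∀ t ∈ Ico 0 T, (t, p t) ∈ funnelSet Φ G D) :
    (∃ B, ∀ t ∈ Ico 0 T, ‖closedLoop A Φ G D t (p t)‖ ≤ B) ∧
      ∀ q, Tendsto p (𝓝[Ico 0 T] T) (𝓝 q) → (T, q) ∈ funnelSet Φ G D := by
  classical
  have hmax : ∀ t ∈ Ico 0 T, max t 0 = t := fun t ht => max_eq_left ht.1
  have hin : ∀ t ∈ Ico 0 T, InFunnels Φ G D t (p t).1 (p t).2 := fun t ht => by
    have : InFunnels Φ G D (max t 0) (p t).1 (p t).2 := hmem t ht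
    rwa [hmax t ht] at this
  have key := absBoundedOn_transformed_errors hG hA hΦ hobs hfun
    (hp.isSolution Ico_subset_Ici_self) hin
  constructor
  · obtain ⟨B₁, hB₁, h₁⟩ := exists_uniform_absBound (I := Ico 0 T) (ι := Σ i, Fin (n i))
      (h := fun q t => agentRate A Φ G D t (p t).1 (p t).2 q.1 q.2) fun q => ((key q.1).2 q.2).1
    obtain ⟨B₂, hB₂, h₂⟩ := exists_uniform_absBound (I := Ico 0 T)
      (ι := Σ q : Σ i, Fin (n i), kHop G D.k q.1)
      (h := fun q t => observerRate G D t (p t).1 (p t).2 q.1.1 q.2 q.1.2) fun q =>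
        (((key q.1.1).2 q.1.2).2 q.2 q.2.2).2
    refine ⟨max B₁ B₂, fun t ht => ?_⟩
    rw [Prod.norm_def]
    refine max_le_max ((pi_norm_le_iff_of_nonneg hB₁).2 fun i =>
      (pi_norm_le_iff_of_nonneg hB₁).2 fun a => ?_) ((pi_norm_le_iff_of_nonneg hB₂).2 fun j =>
      (pi_norm_le_iff_of_nonneg hB₂).2 fun i => (pi_norm_le_iff_of_nonneg hB₂).2 fun a => ?_)
    · simp only [closedLoop, hmax t ht]
      exact h₁ ⟨i, a⟩ t ht
    · simp only [closedLoop, hmax t ht]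
      split_ifs with hj
      · exact h₂ ⟨⟨i, a⟩, ⟨j, hj⟩⟩ t ht
      · simpa using hB₂
  · intro q hq
    have hne : (𝓝[Ico 0 T] T).NeBot := by
      rw [← mem_closure_iff_nhdsWithin_neBot, closure_Ico hT.ne]
      exact ⟨hT.le, le_rfl⟩
    have hpair : Tendsto (fun t => (t, p t)) (𝓝[Ico 0 T] T) (𝓝 (T, q)) :=
      (tendsto_id.mono_left nhdsWithin_le_nhds).prodMk_nhds hq
    -- The normalized errors stay in closed intervals inside the open funnels, and so do their
    -- limits at `T`.
    refine (inFunnels_iff hobs hfun (le_max_right _ _)).2 ⟨fun i => ?_, fun i j a => ?_⟩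
    · obtain ⟨K, hK⟩ := (key i).1
      obtain ⟨lo, hi, hlo, hhi, hIcc⟩ := exists_Icc_of_abs_taskTrans_le K
      have hlim := ((continuous_normError hΦ hfun i).tendsto (T, q)).comp hpair
      have := isClosed_Icc.mem_of_tendsto hlim (b := 𝓝[Ico 0 T] T) (s := Icc lo hi) (by
        filter_upwards [self_mem_nhdsWithin] with t ht
        simp only [Function.comp_apply, hmax t ht]
        exact hIcc _ (((inFunnels_iff hobs hfun ht.1).1 (hin t ht)).1 i) (hK t ht))
      exact ⟨hlo.trans_le this.1, this.2.trans_lt hhi⟩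
    · obtain ⟨K, hK⟩ := (((key i).2 a).2 j j.2).1
      obtain ⟨lo, hi, hlo, hhi, hIcc⟩ := exists_Icc_of_abs_obsTrans_le K
      have hlim := ((continuous_normDisagreement hobs j.2 a).tendsto (T, q)).comp hpair
      have := isClosed_Icc.mem_of_tendsto hlim (b := 𝓝[Ico 0 T] T) (s := Icc lo hi) (by
        filter_upwards [self_mem_nhdsWithin] with t ht
        simp only [Function.comp_apply, hmax t ht]
        exact hIcc _ (((inFunnels_iff hobs hfun ht.1).1 (hin t ht)).2 i j a) (hK t ht))
      exact ⟨hlo.trans_le this.1, this.2.trans_lt hhi⟩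

/-- Inside the funnels, the inner formula of a task holds during its time window. -/
lemma InFunnels.holds (hG : G.Connected) (hΦ : Φ.Admissible G) (hobs : D.ObserverOK Φ G)
    (hfun : D.FunnelsOK Φ G) {i : V} {t : ℝ} (ht : t ∈ (Φ.task i).window (D.tStar i)) {x : State n}
    {xhat : Estimates n} (hin : InFunnels Φ G D t x xhat) : (Φ.task i).inner.Holds x := by
  have ht0 := Temporal.nonneg_of_mem_window (hΦ.wellFormed i) (hfun.tStar_mem i) ht
  refine NonTemporal.holds_of_robustness_pos (hΦ.smoothing_pos i)
    (hfun.ρt_spec i t ht0 x xhat (fun j hj a => ?_) ?_)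
  · exact abs_estimate_sub_lt hG hobs ht0 hin (mem_kHop_of_estimated hG hobs hj) a
  -- The funnel gives `ρ_i(x̂) - ρt > ρmax - γ`, which is positive on the window.
  · have h1 := (hin.task i).1
    have h2 := hfun.γ_window i t ht
    rw [Design.Γ] at h1
    linarith

end Trapping

end STLControl

/-! ### Assembly of the main theorem -/

theorem theorem2 {V : Type*} [Fintype V] [DecidableEq V] {n m : V → ℕ}
    (A : STLControl.Agents n m) (hA : A.Regular)
    (G : SimpleGraph V) (hG : G.Connected)
    (Φ : STLControl.Spec n) (hΦ : Φ.Admissible G)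
    (D : STLControl.Design n) (hobs : D.ObserverOK Φ G) (hfun : D.FunnelsOK Φ G)
    (x₀ : STLControl.State n) (xhat₀ : STLControl.Estimates n)
    (hinit : STLControl.InFunnels Φ G D 0 x₀ xhat₀) :
    -- the closed loop has a solution on `[0, ∞)`
    (∃ (x : ℝ → STLControl.State n) (xhat : ℝ → STLControl.Estimates n),
      STLControl.IsSolution A Φ G D (Set.Ici 0) x xhat ∧ x 0 = x₀ ∧ xhat 0 = xhat₀) ∧
    -- no solution ends in finite time
    (∀ T : ℝ, 0 < T → ∀ (x : ℝ → STLControl.State n) (xhat : ℝ → STLControl.Estimates n),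
      STLControl.IsSolution A Φ G D (Set.Ico 0 T) x xhat → x 0 = x₀ → xhat 0 = xhat₀ →
      ∃ (y : ℝ → STLControl.State n) (yhat : ℝ → STLControl.Estimates n),
        STLControl.IsSolution A Φ G D (Set.Ici 0) y yhat ∧
        Set.EqOn y x (Set.Ico 0 T) ∧ Set.EqOn yhat xhat (Set.Ico 0 T)) ∧
    -- along every solution, the feedback law is well defined and all tasks are satisfied
    (∀ (x : ℝ → STLControl.State n) (xhat : ℝ → STLControl.Estimates n),
      STLControl.IsSolution A Φ G D (Set.Ici 0) x xhat → x 0 = x₀ → xhat 0 = xhat₀ →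
      (∀ t, 0 ≤ t → STLControl.InFunnels Φ G D t (x t) (xhat t)) ∧
      (∀ l : Φ.Cluster G, Φ.ClusterSat G l x) ∧
      Φ.GlobalSat x) := by
  classical
  open STLControl in
  have hU := isOpen_funnelSet hΦ hobs hfun
  have hF := continuousOn_closedLoop hA hΦ hobs hfun
  have h₀ : ((0 : ℝ), (x₀, xhat₀)) ∈ funnelSet Φ G D := by
    change InFunnels Φ G D (max 0 0) x₀ xhat₀
    rwa [max_self]
  have trap : ∀ T > 0, ∀ p : ℝ → State n × Estimates n, p 0 = (x₀, xhat₀) →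
      SolvesOn (closedLoop A Φ G D) (Ico 0 T) p → (∀ t ∈ Ico 0 T, (t, p t) ∈ funnelSet Φ G D) → _ :=
    fun T hT p _ hp hmem => closedLoop_trapped hG hA hΦ hobs hfun hT hp hmem
  have hmask : ∀ (x : ℝ → State n) (xhat : ℝ → Estimates n), x 0 = x₀ → xhat 0 = xhat₀ →
      (fun t => (x t, maskEstimates G D.k xhat₀ (xhat t))) 0 = (x₀, xhat₀) := fun x xhat hx hxhat => by
    simp only [hx, hxhat, maskEstimates_self]
  refine ⟨?_, fun T hT x xhat hsol hx hxhat => ?_, fun x xhat hsol hx hxhat => ?_⟩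
  · obtain ⟨p, hp, hp0⟩ := exists_solution_of_trapped hU hF h₀ trap
    exact ⟨_, _, hp.isSolution Subset.rfl, congrArg Prod.fst hp0, congrArg Prod.snd hp0⟩
  · obtain ⟨p, hp, hpx⟩ := SolvesOn.exists_global_of_trapped hU hF h₀ trap hT
      (hmask x xhat hx hxhat) (hsol.solvesOn hG hobs Ico_subset_Ici_self xhat₀)
    have hsol' := hp.isSolution Subset.rfl
    -- The continued solution has frozen entries where no observer exists; the original ones are put
    -- back so that `yhat` agrees with `xhat` on `[0, T)`.
    let yhat : ℝ → Estimates n := fun t j i a =>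
      if j ∈ kHop G D.k i then (p t).2 j i a else xhat t j i a
    have hy : ∀ t, ∀ i, ∀ j ∈ kHop G D.k i, ∀ a, (p t).2 j i a = yhat t j i a :=
      fun t i j hj a => (if_pos hj).symm
    refine ⟨fun t => (p t).1, yhat, ⟨fun t ht i => ?_, fun t ht i j hj a => ?_⟩,
      fun t ht => congrArg Prod.fst (hpx ht), fun t ht => ?_⟩
    · have h1 : HasDerivWithinAt (fun s => (p s).1 i) (agentRate A Φ G D t (p t).1 (p t).2 i) _ _ :=
        hsol'.agents t ht i
      rw [agentRate_congr hG hobs (hy t)] at h1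
      exact h1
    · rw [← observerRate_congr (hy t) hj]
      refine (hsol'.observers t ht i j hj a).congr (fun s _ => (hy s i j hj a).symm)
        (hy t i j hj a).symm
    · funext j i a
      by_cases hj : j ∈ kHop G D.k i
      · rw [← hy t i j hj a, hpx ht]
        exact maskEstimates_of_mem hj a
      · exact if_neg hj
  · have hin : ∀ t, 0 ≤ t → InFunnels Φ G D t (x t) (xhat t) := fun t ht => by
      have h1 := SolvesOn.mem_of_trapped hU h₀
        (fun T hT p h1 h2 h3 => (trap T hT p h1 h2 h3).2) (T := t + 1) (hmask x xhat hx hxhat)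
        ((hsol.solvesOn hG hobs Subset.rfl xhat₀).mono Ico_subset_Ici_self) t ⟨ht, by linarith⟩
      have h2 : InFunnels Φ G D (max t 0) (x t) (maskEstimates G D.k xhat₀ (xhat t)) := h1
      rw [max_eq_left ht] at h2
      exact h2.congr hG hobs fun i j hj a => maskEstimates_of_mem hj a
    have hsat : Φ.GlobalSat x := fun i =>
      Temporal.sat_of_window (hfun.tStar_mem i) fun t ht => (hin t
        (Temporal.nonneg_of_mem_window (hΦ.wellFormed i) (hfun.tStar_mem i) ht)).holds
          hG hΦ hobs hfun ht
    exact ⟨hin, fun l i _ => hsat i, hsat⟩
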